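/- Let $A$ and $B$ be two stable matching instances over the same $n$ boys and $n$ girls with complete strict preference lists, where $B$ is obtained from $A$ by an upward shift: in the list of one agent (a girl or a boy), one entry is moved up to an earlier position, the entries it passes keep their relative order, and all other lists are unchanged. Let $\mathcal{M}_A,\mathcal{M}_B$ be the sets of (perfect) stable matchings of $A$ and $B$, put $\mathcal{M}_{AB}=\mathcal{M}_A\setminus\mathcal{M}_B$, and assume $\mathcal{M}_{AB}\neq\emptyset$. A matching $M$ dominates $M'$ if every boy weakly prefers (in $A$) his partner in $M$ to his partner in $M'$; the boy-optimal matching of a set of matchings is the member that dominates all members. The meet (join) of two matchings gives each boy the more (less) preferred of his two partners; $\mathcal{L}_{AB}$ is the lattice formed by $\mathcal{M}_{AB}$ with dominance, meet and join. Let $M_0$ be the boy-optimal matching of $\mathcal{M}_A$. For $M\in\mathcal{M}_A$ and a boy $b$ let $s_M(b)$ be the first girl in $b$'s list who strictly prefers $b$ to her partner in $M$. A rotation exposed in $M$ is a nonempty cyclic sequence of distinct pairs $b_0g_0,\dots,b_{r-1}g_{r-1}$ of $M$ such that $s_M(b_i)=g_{i+1}$ for all $i$ (indices modulo $r$); eliminating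 it from $M$ gives the matching $M/\rho$ in which each $b_i$ is matched to $g_{i+1}$ and all other boys keep their partners. Let $\Pi_A$ be the set of all rotations exposed in matchings of $\mathcal{M}_A$, with $\rho\preceq\sigma$ if $\rho=\sigma$ or every sequence of eliminations from $M_0$ to a matching in which $\sigma$ is exposed contains $\rho$. A subset $C$ of a set $P$ of rotations is closed if $\sigma\in C$, $\rho\in P$, $\rho\preceq\sigma$ imply $\rho\in C$. A set $C$ of rotations generates $M$ from $M'$ if eliminating the rotations of $C$, starting from $M'$, in any order compatible with $\preceq$ is possible and gives $M$. A rotation $\rho$ goes into $\mathcal{M}_{AB}$ if it is exposed in some $M\in\mathcal{M}_A\setminus\mathcal{M}_{AB}$ with $M/\rho\in\mathcal{M}_{AB}$, and out of $\mathcal{M}_{AB}$ if it is exposed in some $M\in\mathcal{M}_{AB}$ with $M/\rho\notin\mathcal{M}_{AB}$. Then there is at most one rotation $\rho_{\mathrm{in}}$ going into $\mathcal{M}_{AB}$ and at most one rotation $\rho_{\mathrm{out}}$ going out of it. Let $\Pi_{\mathrm{in}}=\{\rho\in\Pi_A:\rho\preceq\rho_{\mathrm{in}}\}$ and $\Pi_{\mathrm{out}}=\{\rho\in\Pi_A:\rho\succeq\rho_{\mathrm{out}}\}$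 (empty if $\rho_{\mathrm{in}}$, respectively $\rho_{\mathrm{out}}$, does not exist). The set $\Pi_{\mathrm{in}}$ generates from $M_0$ a matching $M_{\mathrm{boy}}$, and this is the boy-optimal matching of $\mathcal{M}_{AB}$. Moreover, $\Pi_{AB}=\Pi_A\setminus(\Pi_{\mathrm{in}}\cup\Pi_{\mathrm{out}})$ with the order $\preceq$ is the rotation poset generating $\mathcal{L}_{AB}$: $\preceq$ is a partial order on $\Pi_{AB}$; every closed subset $C$ of $\Pi_{AB}$ generates a matching $M_C$ from $M_{\mathrm{boy}}$; the map $C\mapsto M_C$ is a bijection from the closed subsets of $\Pi_{AB}$ onto $\mathcal{M}_{AB}$; $C\subseteq D$ if and only if $M_C$ dominates $M_D$; and $C\cup D$ and $C\cap D$ are closed and generate the join and the meet of $M_C$ and $M_D$. -/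

import Mathlib

/-- An instance of the stable matching problem with complete strict preference lists of length `n`:
`boyList b i` is the `i`-th girl in the list of the boy `b` and `girlList g i` is the `i`-th boy
in the list of the girl `g`; position `0` is the most preferred one. -/
structure SMInstance (Boy Girl : Type*) (n : ℕ) where
  boyList : Boy → (Fin n ≃ Girl)
  girlList : Girl → (Fin n ≃ Boy)

/-- A rotation is written as a cyclic sequence of boy-girl pairs. -/
abbrev CyclicPairs (Boy Girl : Type*) := Cycle (Boy × Girl)

/-- The list `l'` arises from the list `l` by an upward shift: the entry at some position `q` is
moved up to an earlier position `p`, the entries at the positions `p, …, q - 1` move down by one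
place and all other entries stay where they are. -/
def IsUpwardShift {n : ℕ} {X : Type*} (l l' : Fin n ≃ X) : Prop :=
  ∃ p q : Fin n, p < q ∧ l' p = l q ∧
    (∀ i j : Fin n, p ≤ i → i < q → (j : ℕ) = (i : ℕ) + 1 → l' j = l i) ∧
    (∀ i : Fin n, i < p ∨ q < i → l' i = l i)

namespace SMInstance

variable {Boy Girl : Type*} {n : ℕ}

/-- Boy `b` strictly prefers `g` to `g'`. -/
def BoyPrefers (A : SMInstance Boy Girl n) (b : Boy) (g g' : Girl) : Prop :=
  (A.boyList b).symm g < (A.boyList b).symm g'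

/-- Girl `g` strictly prefers `b` to `b'`. -/
def GirlPrefers (A : SMInstance Boy Girl n) (g : Girl) (b b' : Boy) : Prop :=
  (A.girlList g).symm b < (A.girlList g).symm b'

/-- A perfect matching is a bijection `M`, where `M b` is the partner of `b` and `M.symm g` the
partner of `g`. The pair `b g` blocks `M` if both prefer each other to their partners. -/
def Blocks (A : SMInstance Boy Girl n) (M : Boy ≃ Girl) (b : Boy) (g : Girl) : Prop :=
  A.BoyPrefers b g (M b) ∧ A.GirlPrefers g b (M.symm g)

/-- The set of stable matchings. -/
def stableMatchings (A : SMInstance Boy Girl n) : Set (Boy ≃ Girl) :=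
  {M | ∀ b g, ¬ A.Blocks M b g}

/-- `M` dominates `M'`: every boy weakly prefers his partner in `M`. -/
def Dominates (A : SMInstance Boy Girl n) (M M' : Boy ≃ Girl) : Prop :=
  ∀ b, M b = M' b ∨ A.BoyPrefers b (M b) (M' b)

/-- `M` is the boy-optimal matching of the set `L`. -/
def IsBoyOptimalIn (A : SMInstance Boy Girl n) (L : Set (Boy ≃ Girl)) (M : Boy ≃ Girl) : Prop :=
  M ∈ L ∧ ∀ M' ∈ L, A.Dominates M M'

/-- In `N`, every boy has the more preferred one of his partners in `M` and `M'`. -/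
def IsMeet (A : SMInstance Boy Girl n) (M M' N : Boy ≃ Girl) : Prop :=
  ∀ b, (N b = M b ∧ ¬ A.BoyPrefers b (M' b) (M b)) ∨
    (N b = M' b ∧ ¬ A.BoyPrefers b (M b) (M' b))

/-- In `N`, every boy has the less preferred one of his partners in `M` and `M'`. -/
def IsJoin (A : SMInstance Boy Girl n) (M M' N : Boy ≃ Girl) : Prop :=
  ∀ b, (N b = M b ∧ ¬ A.BoyPrefers b (M b) (M' b)) ∨
    (N b = M' b ∧ ¬ A.BoyPrefers b (M' b) (M b))

/-- `g` is `s_M(b)`, the first girl in the list of `b` who strictly prefers `b` to her partner. -/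
def IsNextGirl (A : SMInstance Boy Girl n) (M : Boy ≃ Girl) (b : Boy) (g : Girl) : Prop :=
  A.GirlPrefers g b (M.symm g) ∧
    ∀ g', A.GirlPrefers g' b (M.symm g') → ¬ A.BoyPrefers b g' g

/-- The cyclic sequence `ρ` of pairs `b_i g_i` is a rotation exposed in the stable matching `M`:
it is nonempty, its pairs are distinct and matched in `M`, and the partner of `s_M(b_i)` is
`b_{i+1}`, with indices taken cyclically. -/
def Exposed (A : SMInstance Boy Girl n) (M : Boy ≃ Girl) (ρ : CyclicPairs Boy Girl) : Prop :=
  M ∈ A.stableMatchings ∧ ρ ≠ Cycle.nil ∧ ρ.Nodup ∧ (∀ p ∈ ρ, M p.1 = p.2) ∧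
    ρ.Chain (fun p q => ∃ g, A.IsNextGirl M p.1 g ∧ M.symm g = q.1)

/-- `ρ` is exposed in `M` and `M'` is the result `M / ρ` of eliminating it: each boy in `ρ` gets
`s_M(b)` and every other boy keeps his partner. -/
def Eliminates (A : SMInstance Boy Girl n) (ρ : CyclicPairs Boy Girl) (M M' : Boy ≃ Girl) : Prop :=
  A.Exposed M ρ ∧ (∀ p ∈ ρ, A.IsNextGirl M p.1 (M' p.1)) ∧
    ∀ b, (∀ p ∈ ρ, p.1 ≠ b) → M' b = M b

/-- Eliminating the rotations of the list one after the other, starting from the first matching,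
is possible and leads to the second one. -/
def EliminatesSeq (A : SMInstance Boy Girl n) :
    List (CyclicPairs Boy Girl) → (Boy ≃ Girl) → (Boy ≃ Girl) → Prop
  | [], M, M' => M = M'
  | ρ :: l, M, M' => ∃ N, A.Eliminates ρ M N ∧ A.EliminatesSeq l N M'

/-- The set `Π_A` of all rotations of the instance. -/
def rotations (A : SMInstance Boy Girl n) : Set (CyclicPairs Boy Girl) :=
  {ρ | ∃ M, A.Exposed M ρ}

/-- The order `ρ ≼ σ` of the rotation poset: `ρ = σ`, or every sequence of eliminations from the
boy-optimal stable matching to a matching in which `σ` is exposed contains `ρ`. -/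
def Precedes (A : SMInstance Boy Girl n) (ρ σ : CyclicPairs Boy Girl) : Prop :=
  ρ = σ ∨ ∀ M₀, A.IsBoyOptimalIn A.stableMatchings M₀ →
    ∀ l M, A.EliminatesSeq l M₀ M → A.Exposed M σ → ρ ∈ l

/-- `C` is a closed subset of the set `P` of rotations with the order `≼`. -/
def IsClosedIn (A : SMInstance Boy Girl n) (P C : Set (CyclicPairs Boy Girl)) : Prop :=
  C ⊆ P ∧ ∀ σ ∈ C, ∀ ρ ∈ P, A.Precedes ρ σ → ρ ∈ C

/-- The list enumerates `C` without repetition, in an order compatible with `≼`. -/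
def IsTopologicalOrder (A : SMInstance Boy Girl n) (C : Set (CyclicPairs Boy Girl))
    (l : List (CyclicPairs Boy Girl)) : Prop :=
  l.Nodup ∧ (∀ ρ, ρ ∈ l ↔ ρ ∈ C) ∧ l.Pairwise (fun ρ σ => ¬ A.Precedes σ ρ)

/-- Starting from `M₀`, the set `C` of rotations generates `M`: `C` has a topological order, and
eliminating the rotations of `C` in any such order is possible and leads to `M`. -/
def Generates (A : SMInstance Boy Girl n) (M₀ : Boy ≃ Girl) (C : Set (CyclicPairs Boy Girl))
    (M : Boy ≃ Girl) : Prop :=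
  (∃ l, A.IsTopologicalOrder C l) ∧ ∀ l, A.IsTopologicalOrder C l → A.EliminatesSeq l M₀ M

/-- The set `P` of rotations with the order `≼` is a rotation poset generating the lattice `L` of
matchings from `M₀`, where `Φ C` is the matching generated by the closed set `C`. -/
structure IsRotationPosetVia (A : SMInstance Boy Girl n) (P : Set (CyclicPairs Boy Girl))
    (M₀ : Boy ≃ Girl) (L : Set (Boy ≃ Girl))
    (Φ : Set (CyclicPairs Boy Girl) → (Boy ≃ Girl)) : Prop where
  subset_rotations : P ⊆ A.rotations
  refl : ∀ ρ ∈ P, A.Precedes ρ ρ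
  trans : ∀ ρ ∈ P, ∀ σ ∈ P, ∀ τ ∈ P, A.Precedes ρ σ → A.Precedes σ τ → A.Precedes ρ τ
  antisymm : ∀ ρ ∈ P, ∀ σ ∈ P, A.Precedes ρ σ → A.Precedes σ ρ → ρ = σ
  generates : ∀ C, A.IsClosedIn P C → A.Generates M₀ C (Φ C)
  bijOn : Set.BijOn Φ {C | A.IsClosedIn P C} L
  dominates_iff : ∀ C D, A.IsClosedIn P C → A.IsClosedIn P D →
    (C ⊆ D ↔ A.Dominates (Φ C) (Φ D))
  union_isJoin : ∀ C D, A.IsClosedIn P C → A.IsClosedIn P D →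
    A.IsClosedIn P (C ∪ D) ∧ A.IsJoin (Φ C) (Φ D) (Φ (C ∪ D))
  inter_isMeet : ∀ C D, A.IsClosedIn P C → A.IsClosedIn P D →
    A.IsClosedIn P (C ∩ D) ∧ A.IsMeet (Φ C) (Φ D) (Φ (C ∩ D))

/-- The rotation poset `P` generates the lattice `L` of matchings, starting from `M₀`. -/
def IsRotationPosetGenerating (A : SMInstance Boy Girl n) (P : Set (CyclicPairs Boy Girl))
    (M₀ : Boy ≃ Girl) (L : Set (Boy ≃ Girl)) : Prop :=
  ∃ Φ : Set (CyclicPairs Boy Girl) → (Boy ≃ Girl), A.IsRotationPosetVia P M₀ L Φ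

/-- The rotations going into the set `L` of stable matchings. -/
def rotationsInto (A : SMInstance Boy Girl n) (L : Set (Boy ≃ Girl)) :
    Set (CyclicPairs Boy Girl) :=
  {ρ | ∃ M M', A.Eliminates ρ M M' ∧ M ∉ L ∧ M' ∈ L}

/-- The rotations going out of the set `L` of stable matchings. -/
def rotationsOutOf (A : SMInstance Boy Girl n) (L : Set (Boy ≃ Girl)) :
    Set (CyclicPairs Boy Girl) :=
  {ρ | ∃ M M', A.Eliminates ρ M M' ∧ M ∈ L ∧ M' ∉ L}

/-- `B` results from `A` by an upward shift in the list of one girl. -/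
def IsGirlShift (A B : SMInstance Boy Girl n) : Prop :=
  B.boyList = A.boyList ∧ ∃ g, IsUpwardShift (A.girlList g) (B.girlList g) ∧
    ∀ g', g' ≠ g → B.girlList g' = A.girlList g'

/-- `B` results from `A` by an upward shift in the list of one boy. -/
def IsBoyShift (A B : SMInstance Boy Girl n) : Prop :=
  B.girlList = A.girlList ∧ ∃ b, IsUpwardShift (A.boyList b) (B.boyList b) ∧
    ∀ b', b' ≠ b → B.boyList b' = A.boyList b'

/-- `M_AB`: the matchings that are stable in `A` and not stable in `B`. -/
def lostMatchings (A B : SMInstance Boy Girl n) : Set (Boy ≃ Girl) :=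
  A.stableMatchings \ B.stableMatchings

/-- `Π_in`: the rotations of `A` preceding or equal to the rotation going into `M_AB`; it is empty
if there is no such rotation. -/
def rotationsIn (A B : SMInstance Boy Girl n) : Set (CyclicPairs Boy Girl) :=
  {ρ | ρ ∈ A.rotations ∧ ∃ ρin ∈ A.rotationsInto (A.lostMatchings B), A.Precedes ρ ρin}

/-- `Π_out`: the rotations of `A` succeeding or equal to the rotation going out of `M_AB`; it is
empty if there is no such rotation. -/
def rotationsOut (A B : SMInstance Boy Girl n) : Set (CyclicPairs Boy Girl) :=
  {ρ | ρ ∈ A.rotations ∧ ∃ ρout ∈ A.rotationsOutOf (A.lostMatchings B), A.Precedes ρout ρ}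

end SMInstance

/-! A stable matching `M` is encoded by `pastRotations M`, the rotations whose boys are all strictly
worse off in `M` than in their pairs of the rotation. One elimination adds exactly one rotation to
this set (`Eliminates.eq_of_mem_pastRotations`), and every dominated stable matching is reached by
eliminations (`exists_eliminates_dominates`). Hence dominance becomes inclusion, meets and joins
become intersections and unions, and the sets that occur are exactly the closed ones
(`exists_pastRotations_eq`).

Let the shift move a boy `b` up in the list of a girl `g`. Only the pair `b g` can newly block, and
it does so iff `b` prefers `g` to his partner and the partner of `g` stood at or after the target
position. Each condition is a threshold on one agent's partner. As the boys get worse off, the first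
can only become true and the second only false, so the lost matchings are those inside a prime
filter `U` and outside a prime filter `V`; a boy's shift is similar. A prime filter is always
entered by the same rotation, and membership then means having that rotation in the past
(`IsPrimeFilter.mem_iff`). So the lost matchings are those whose past contains `Π_in` and avoids
`Π_out`: an interval of closed sets. Deleting the constant part `Π_in` gives the poset `Π_AB`. -/

namespace Cycle

/-! ### Cycles as orbits -/

variable {α : Type*} {r r' : α → α → Prop}

theorem Chain.exists_rel_of_mem {c : Cycle α} (h : c.Chain r) {p : α} (hp : p ∈ c) :
    ∃ q ∈ c, r p q := by
  obtain ⟨l⟩ := c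
  obtain ⟨s, t, rfl⟩ := List.append_of_mem (show p ∈ l from hp)
  have e : (Quot.mk _ (s ++ p :: t) : Cycle α) = ((p :: (t ++ s) : List α) : Cycle α) :=
    Cycle.coe_eq_coe.2 ⟨s.length, by simp⟩
  rw [e, chain_coe_cons] at h
  rw [e]
  rcases hts : t ++ s with _ | ⟨q, m⟩
  · rw [hts] at h
    exact ⟨p, by simp, by simpa using h⟩
  · rw [hts] at h
    exact ⟨q, by simp, (List.isChain_cons_cons.1 h).1⟩

theorem Chain.exists_mem_rel {c : Cycle α} (h : c.Chain r) {q : α} (hq : q ∈ c) :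
    ∃ p ∈ c, r p q := by
  obtain ⟨l⟩ := c
  obtain ⟨s, t, rfl⟩ := List.append_of_mem (show q ∈ l from hq)
  have e : (Quot.mk _ (s ++ q :: t) : Cycle α) = ((q :: (t ++ s) : List α) : Cycle α) :=
    Cycle.coe_eq_coe.2 ⟨s.length, by simp⟩
  rw [e, chain_coe_cons] at h
  rw [e]
  rcases List.eq_nil_or_concat (t ++ s) with hts | ⟨m, p, hts⟩
  · rw [hts] at h
    exact ⟨q, by simp, by simpa using h⟩
  · rw [hts] at h
    refine ⟨p, by simp [hts], ?_⟩
    have : List.IsChain r ((q :: m) ++ [p, q]) := by simpa using h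
    exact (List.isChain_cons_cons.1 (List.isChain_append.1 this).2.1).1

theorem Chain.imp_of_mem {c : Cycle α} (h : c.Chain r)
    (H : ∀ p ∈ c, ∀ q ∈ c, r p q → r' p q) : c.Chain r' := by
  induction c with
  | nil => trivial
  | cons a l _ =>
    rw [chain_coe_cons] at h ⊢
    refine List.IsChain.imp_of_mem_imp ?_ h
    intro p q hp hq
    refine H p ?_ q ?_ <;> simp_all <;> tauto

theorem isChain_eq_iterate {F : α → α} : ∀ (l : List α) (x : α),
    List.IsChain (fun p q => q = F p) (x :: l) → x :: l = List.iterate F x (l.length + 1)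
  | [], x, _ => by simp
  | y :: l, x, h => by
    obtain ⟨rfl, h⟩ := List.isChain_cons_cons.1 h
    rw [isChain_eq_iterate l (F x) h]
    simp

/-- Such a cycle is traversed by iterating `F`; having no duplicates forces its length to be the
minimal period. -/
theorem Chain.eq_periodicOrbit {F : α → α} {c : Cycle α} (h : c.Chain (fun p q => q = F p))
    (hn : c.Nodup) {x : α} (hx : x ∈ c) : c = Function.periodicOrbit F x := by
  obtain ⟨l⟩ := c
  obtain ⟨s, t, rfl⟩ := List.append_of_mem (show x ∈ l from hx)
  have e : (Quot.mk _ (s ++ x :: t) : Cycle α) = ((x :: (t ++ s) : List α) : Cycle α) :=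
    Cycle.coe_eq_coe.2 ⟨s.length, by simp⟩
  rw [e] at h hn ⊢
  generalize t ++ s = m at h hn
  rw [chain_coe_cons] at h
  rw [nodup_coe_iff] at hn
  have hfull := isChain_eq_iterate _ _ h
  have hm : x :: m = List.iterate F x (m.length + 1) :=
    isChain_eq_iterate _ _ (List.isChain_append (l₁ := x :: m) (l₂ := [x]) |>.1 h).1
  have hper : F^[m.length + 1] x = x := by
    have h1 : (x :: (m ++ [x]))[m.length + 1]'(by simp) = x := by simp
    simp only [hfull, List.getElem_iterate] at h1
    exact h1
  have hmin : Function.minimalPeriod F x = m.length + 1 := by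
    apply le_antisymm (Function.IsPeriodicPt.minimalPeriod_le (by omega) hper)
    by_contra! hlt
    have hpos : 0 < Function.minimalPeriod F x :=
      Function.IsPeriodicPt.minimalPeriod_pos (n := m.length + 1) (by omega) hper
    have hk : F^[Function.minimalPeriod F x] x = x := Function.iterate_minimalPeriod
    generalize Function.minimalPeriod F x = k at hlt hpos hk
    rw [hm] at hn
    have h0 := (hn.getElem_inj_iff (i := 0) (j := k)
      (hi := by simp) (hj := by simpa using hlt)).1
      (by rw [List.getElem_iterate, List.getElem_iterate, hk]; rfl)
    omega
  rw [Function.periodicOrbit_def, hmin, hm]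
  congr 1
  apply List.ext_getElem <;> simp

theorem eq_of_chain_of_mem {c d : Cycle α} (hc : c.Chain r) (hd : d.Chain r) (hcn : c.Nodup)
    (hdn : d.Nodup) (hr : ∀ p q q', r p q → r p q' → q = q') {x : α} (hxc : x ∈ c)
    (hxd : x ∈ d) : c = d := by
  classical
  -- The default value is harmless: the chains only use `F` where `r` relates the point to
  -- something.
  let F : α → α := fun p => if h : ∃ q, r p q then h.choose else p
  have hF : ∀ p q, r p q → q = F p := by
    intro p q h
    have h' : ∃ q, r p q := ⟨q, h⟩
    simp only [F, dif_pos h']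
    exact hr _ _ _ h h'.choose_spec
  rw [(hc.imp hF).eq_periodicOrbit hcn hxc, (hd.imp hF).eq_periodicOrbit hdn hxd]

end Cycle

/-! ### The lattice of stable matchings -/

namespace SMInstance

variable {Boy Girl : Type*} {n : ℕ} {A : SMInstance Boy Girl n} {M M' N N' : Boy ≃ Girl}

/-- The instance with the roles of the boys and the girls exchanged. -/
def swap (A : SMInstance Boy Girl n) : SMInstance Girl Boy n := ⟨A.girlList, A.boyList⟩

theorem dominates_iff_le :
    A.Dominates M M' ↔ ∀ b, (A.boyList b).symm (M b) ≤ (A.boyList b).symm (M' b) := by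
  refine forall_congr' fun b => ?_
  rw [le_iff_lt_or_eq, (A.boyList b).symm.injective.eq_iff, or_comm]
  rfl

theorem isMeet_iff_le : A.IsMeet M M' N ↔
    ∀ b, (N b = M b ∧ (A.boyList b).symm (M b) ≤ (A.boyList b).symm (M' b)) ∨
      (N b = M' b ∧ (A.boyList b).symm (M' b) ≤ (A.boyList b).symm (M b)) := by
  simp only [IsMeet, BoyPrefers, not_lt]

theorem isJoin_iff_le : A.IsJoin M M' N ↔
    ∀ b, (N b = M b ∧ (A.boyList b).symm (M' b) ≤ (A.boyList b).symm (M b)) ∨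
      (N b = M' b ∧ (A.boyList b).symm (M b) ≤ (A.boyList b).symm (M' b)) := by
  simp only [IsJoin, BoyPrefers, not_lt]

theorem IsMeet.dominates_left (h : A.IsMeet M M' N) : A.Dominates N M := by
  rw [isMeet_iff_le] at h
  rw [dominates_iff_le]
  intro b
  rcases h b with h | h <;> rw [h.1]
  exact h.2

theorem IsMeet.dominates_right (h : A.IsMeet M M' N) : A.Dominates N M' := by
  rw [isMeet_iff_le] at h
  rw [dominates_iff_le]
  intro b
  rcases h b with h | h <;> rw [h.1]
  exact h.2

theorem IsJoin.dominates_left (h : A.IsJoin M M' N) : A.Dominates M N := by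
  rw [isJoin_iff_le] at h
  rw [dominates_iff_le]
  intro b
  rcases h b with h | h <;> rw [h.1]
  exact h.2

theorem IsJoin.dominates_right (h : A.IsJoin M M' N) : A.Dominates M' N := by
  rw [isJoin_iff_le] at h
  rw [dominates_iff_le]
  intro b
  rcases h b with h | h <;> rw [h.1]
  exact h.2

theorem IsMeet.apply_eq_or (h : A.IsMeet M M' N) (b : Boy) : N b = M b ∨ N b = M' b :=
  (h b).imp And.left And.left

theorem IsJoin.apply_eq_or (h : A.IsJoin M M' N) (b : Boy) : N b = M b ∨ N b = M' b :=
  (h b).imp And.left And.left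

theorem Dominates.refl (A : SMInstance Boy Girl n) (M : Boy ≃ Girl) : A.Dominates M M :=
  fun _ => Or.inl rfl

theorem Dominates.trans {M₁ M₂ M₃ : Boy ≃ Girl} (h : A.Dominates M₁ M₂)
    (h' : A.Dominates M₂ M₃) : A.Dominates M₁ M₃ := by
  rw [dominates_iff_le] at *
  exact fun b => (h b).trans (h' b)

theorem Dominates.antisymm (h : A.Dominates M M') (h' : A.Dominates M' M) : M = M' := by
  rw [dominates_iff_le] at *
  exact Equiv.ext fun b => (A.boyList b).symm.injective ((h b).antisymm (h' b))

theorem stable_girl_le (hM : M ∈ A.stableMatchings) {b : Boy} {g : Girl}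
    (h : (A.boyList b).symm g < (A.boyList b).symm (M b)) :
    (A.girlList g).symm (M.symm g) ≤ (A.girlList g).symm b :=
  not_lt.1 fun h' => hM b g ⟨h, h'⟩

theorem stable_boy_le (hM : M ∈ A.stableMatchings) {b : Boy} {g : Girl}
    (h : (A.girlList g).symm b < (A.girlList g).symm (M.symm g)) :
    (A.boyList b).symm (M b) ≤ (A.boyList b).symm g :=
  not_lt.1 fun h' => hM b g ⟨h', h⟩

theorem symm_mem_swap (hM : M ∈ A.stableMatchings) : M.symm ∈ A.swap.stableMatchings :=
  fun g b h => hM b g ⟨h.2, h.1⟩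

theorem symm_mem_of_swap {M : Girl ≃ Boy} (hM : M ∈ A.swap.stableMatchings) :
    M.symm ∈ A.stableMatchings :=
  fun b g h => hM g b ⟨h.2, h.1⟩

/-- Opposition of interests. -/
theorem Dominates.girl_le (h : A.Dominates M M') (hM' : M' ∈ A.stableMatchings) (g : Girl) :
    (A.girlList g).symm (M'.symm g) ≤ (A.girlList g).symm (M.symm g) := by
  rw [dominates_iff_le] at h
  by_contra! hlt
  have h1 := h (M.symm g)
  rw [M.apply_symm_apply] at h1
  have h2 := (A.boyList (M.symm g)).symm.injective (h1.antisymm (stable_boy_le hM' hlt))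
  rw [M'.symm_apply_eq.2 h2] at hlt
  exact hlt.false

theorem IsMeet.symm_apply_eq_or (h : A.IsMeet M M' N) (g : Girl) :
    N.symm g = M.symm g ∨ N.symm g = M'.symm g := by
  have := h.apply_eq_or (N.symm g)
  rw [N.apply_symm_apply] at this
  exact this.imp (fun h => (M.symm_apply_eq.2 h).symm) fun h => (M'.symm_apply_eq.2 h).symm

theorem IsJoin.symm_apply_eq_or (h : A.IsJoin M M' N) (g : Girl) :
    N.symm g = M.symm g ∨ N.symm g = M'.symm g := by
  have := h.apply_eq_or (N.symm g)
  rw [N.apply_symm_apply] at this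
  exact this.imp (fun h => (M.symm_apply_eq.2 h).symm) fun h => (M'.symm_apply_eq.2 h).symm

/-- If two boys picked the same girl from different matchings, each would strictly prefer her to his
other partner, and stability of both matchings would make her weakly prefer each of the two to the
other. So the choice is injective, hence bijective by finiteness. -/
theorem exists_isMeet [Finite Boy] (hM : M ∈ A.stableMatchings) (hM' : M' ∈ A.stableMatchings) :
    ∃ N ∈ A.stableMatchings, A.IsMeet M M' N := by
  classical
  let f : Boy → Girl := fun b =>
    if (A.boyList b).symm (M b) ≤ (A.boyList b).symm (M' b) then M b else M' b
  have hf : ∀ b, (f b = M b ∧ (A.boyList b).symm (M b) ≤ (A.boyList b).symm (M' b)) ∨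
      (f b = M' b ∧ (A.boyList b).symm (M' b) ≤ (A.boyList b).symm (M b)) := by
    intro b
    by_cases h : (A.boyList b).symm (M b) ≤ (A.boyList b).symm (M' b)
    · exact Or.inl ⟨by simp [f, h], h⟩
    · exact Or.inr ⟨by simp [f, h], (not_le.1 h).le⟩
  have key : ∀ {K K' : Boy ≃ Girl}, K ∈ A.stableMatchings → K' ∈ A.stableMatchings →
      ∀ b b', K b = K' b' → (A.boyList b).symm (K b) ≤ (A.boyList b).symm (K' b) →
      (A.boyList b').symm (K' b') ≤ (A.boyList b').symm (K b') → b = b' := by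
    intro K K' hK hK' b b' e h1 h2
    by_contra hne
    have s1 : (A.boyList b).symm (K b) < (A.boyList b).symm (K' b) :=
      lt_of_le_of_ne h1 fun h => hne
        (K'.injective (((A.boyList b).symm.injective h).symm.trans e))
    have s2 : (A.boyList b').symm (K' b') < (A.boyList b').symm (K b') :=
      lt_of_le_of_ne h2 fun h => hne
        (K.injective (e.trans ((A.boyList b').symm.injective h)))
    have t1 := stable_girl_le hK' s1
    have t2 := stable_girl_le hK s2
    rw [e, K'.symm_apply_apply] at t1
    rw [← e, K.symm_apply_apply, e] at t2
    exact hne ((A.girlList (K' b')).symm.injective (t2.antisymm t1))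
  have hinj : Function.Injective f := by
    intro b b' e
    rcases hf b with ⟨e1, h1⟩ | ⟨e1, h1⟩ <;> rcases hf b' with ⟨e2, h2⟩ | ⟨e2, h2⟩ <;>
      rw [e1, e2] at e
    · exact M.injective e
    · exact key hM hM' b b' e h1 h2
    · exact key hM' hM b b' e h1 h2
    · exact M'.injective e
  have hbij : Function.Bijective f := by
    have h1 : Function.Bijective (M.symm ∘ f) :=
      Finite.injective_iff_bijective.1 (M.symm.injective.comp hinj)
    exact (Function.Bijective.of_comp_iff' M.symm.bijective f).1 h1
  let N : Boy ≃ Girl := Equiv.ofBijective f hbij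
  have hN : A.IsMeet M M' N := isMeet_iff_le.2 hf
  refine ⟨N, ?_, hN⟩
  rintro b g ⟨h1, h2⟩
  have d1 := dominates_iff_le.1 hN.dominates_left b
  have d2 := dominates_iff_le.1 hN.dominates_right b
  rcases hN.symm_apply_eq_or g with h | h
  · exact hM b g ⟨lt_of_lt_of_le h1 d1, by rwa [h] at h2⟩
  · exact hM' b g ⟨lt_of_lt_of_le h1 d2, by rwa [h] at h2⟩

/-- By duality: the girls' meet is the boys' join, because stability (`key`) turns a girl's
preference between her two partners into the opposite preference of the boy. -/
theorem exists_isJoin [Finite Girl] (hM : M ∈ A.stableMatchings) (hM' : M' ∈ A.stableMatchings) :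
    ∃ N ∈ A.stableMatchings, A.IsJoin M M' N := by
  obtain ⟨K, hK, hmeet⟩ := exists_isMeet (symm_mem_swap hM) (symm_mem_swap hM')
  refine ⟨K.symm, symm_mem_of_swap hK, isJoin_iff_le.2 fun b => ?_⟩
  have key : ∀ {L L' : Boy ≃ Girl}, L ∈ A.stableMatchings → L' ∈ A.stableMatchings → ∀ g b,
      b = L.symm g → (A.girlList g).symm b ≤ (A.girlList g).symm (L'.symm g) →
      g = L b ∧ (A.boyList b).symm (L' b) ≤ (A.boyList b).symm (L b) := by
    rintro L L' hL hL' g _ rfl h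
    refine ⟨by simp, ?_⟩
    by_contra! hlt
    rw [L.apply_symm_apply] at hlt
    have := (A.girlList g).symm.injective (h.antisymm (stable_girl_le hL' hlt))
    rw [this, L'.apply_symm_apply] at hlt
    exact hlt.false
  have hb : K (K.symm b) = b := K.apply_symm_apply b
  rcases isMeet_iff_le.1 hmeet (K.symm b) with ⟨e, h⟩ | ⟨e, h⟩ <;> rw [← e, hb] at h <;>
    rw [hb] at e
  · exact Or.inl (key hM hM' _ _ e h)
  · exact Or.inr (key hM' hM _ _ e h)

theorem finite_matchings (Boy Girl : Type*) [Finite Boy] [Finite Girl] : Finite (Boy ≃ Girl) :=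
  Finite.of_injective _ (DFunLike.coe_injective (F := Boy ≃ Girl))

theorem exists_least [Finite Boy] [Finite Girl] {L : Set (Boy ≃ Girl)}
    (hL : L ⊆ A.stableMatchings) (hne : L.Nonempty)
    (hmeet : ∀ M ∈ L, ∀ M' ∈ L, ∀ N ∈ A.stableMatchings, A.IsMeet M M' N → N ∈ L) :
    ∃ M, A.IsBoyOptimalIn L M := by
  have := finite_matchings Boy Girl
  suffices h : ∀ S : Set (Boy ≃ Girl), S.Finite → S ⊆ L → ∃ M ∈ L, ∀ M' ∈ S, A.Dominates M M' by
    exact h L (Set.toFinite L) subset_rfl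
  intro S hS
  induction S, hS using Set.Finite.induction_on with
  | empty => exact fun _ => ⟨_, hne.some_mem, by simp⟩
  | insert _ _ ih =>
    intro hSL
    rw [Set.insert_subset_iff] at hSL
    obtain ⟨M, hM, h⟩ := ih hSL.2
    obtain ⟨N, hN, hm⟩ := exists_isMeet (hL hM) (hL hSL.1)
    refine ⟨N, hmeet _ hM _ hSL.1 _ hN hm, ?_⟩
    rintro M' (rfl | hM')
    · exact hm.dominates_right
    · exact hm.dominates_left.trans (h _ hM')

theorem exists_greatest [Finite Boy] [Finite Girl] {L : Set (Boy ≃ Girl)}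
    (hL : L ⊆ A.stableMatchings) (hne : L.Nonempty)
    (hjoin : ∀ M ∈ L, ∀ M' ∈ L, ∀ N ∈ A.stableMatchings, A.IsJoin M M' N → N ∈ L) :
    ∃ M ∈ L, ∀ M' ∈ L, A.Dominates M' M := by
  have := finite_matchings Boy Girl
  suffices h : ∀ S : Set (Boy ≃ Girl), S.Finite → S ⊆ L → ∃ M ∈ L, ∀ M' ∈ S, A.Dominates M' M by
    exact h L (Set.toFinite L) subset_rfl
  intro S hS
  induction S, hS using Set.Finite.induction_on with
  | empty => exact fun _ => ⟨_, hne.some_mem, by simp⟩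
  | insert _ _ ih =>
    intro hSL
    rw [Set.insert_subset_iff] at hSL
    obtain ⟨M, hM, h⟩ := ih hSL.2
    obtain ⟨N, hN, hm⟩ := exists_isJoin (hL hM) (hL hSL.1)
    refine ⟨N, hjoin _ hM _ hSL.1 _ hN hm, ?_⟩
    rintro M' (rfl | hM')
    · exact hm.dominates_right
    · exact (h _ hM').trans hm.dominates_left

end SMInstance

/-! ### Exposed rotations and their elimination -/

namespace Cycle

variable {α : Type*} {r : α → α → Prop}

/-- Implication is transitive, so the links of the cycle yield it between any two members. -/
theorem Chain.forall_mem {c : Cycle α} (h : c.Chain r) {P : α → Prop}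
    (H : ∀ p ∈ c, ∀ q ∈ c, r p q → P p → P q) {p : α} (hp : p ∈ c) (hP : P p) :
    ∀ q ∈ c, P q := by
  have : IsTrans α (fun p q => P p → P q) := ⟨fun _ _ _ h1 h2 => h2 ∘ h1⟩
  exact fun q hq => Cycle.chain_iff_pairwise.1 (h.imp_of_mem H) p hp q hq hP

end Cycle

theorem Function.exists_iterate_mem_periodicPts {α : Type*} [Finite α] (f : α → α) (x : α) :
    ∃ k, f^[k] x ∈ Function.periodicPts f := by
  obtain ⟨i, j, hij, h⟩ := Finite.exists_ne_map_eq_of_infinite (fun k => f^[k] x)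
  have key : ∀ i j, i < j → f^[i] x = f^[j] x → ∃ k, f^[k] x ∈ Function.periodicPts f := by
    intro i j hlt h
    refine ⟨i, Function.mk_mem_periodicPts (n := j - i) (by omega) ?_⟩
    rw [Function.IsPeriodicPt, Function.IsFixedPt, ← Function.iterate_add_apply,
      Nat.sub_add_cancel hlt.le, h]
  rcases lt_or_gt_of_ne hij with hlt | hlt
  exacts [key i j hlt h, key j i hlt h.symm]

namespace SMInstance

variable {Boy Girl : Type*} {n : ℕ} {A : SMInstance Boy Girl n} {M M' N N' : Boy ≃ Girl}
  {ρ σ : CyclicPairs Boy Girl}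

theorem IsNextGirl.unique {b : Boy} {g g' : Girl} (h : A.IsNextGirl M b g)
    (h' : A.IsNextGirl M b g') : g = g' :=
  (A.boyList b).symm.injective
    ((not_lt.1 (h'.2 g h.1)).antisymm (not_lt.1 (h.2 g' h'.1))).symm

theorem IsNextGirl.lt {b : Boy} {g : Girl} (h : A.IsNextGirl M b g)
    (hM : M ∈ A.stableMatchings) : (A.boyList b).symm (M b) < (A.boyList b).symm g := by
  refine lt_of_le_of_ne (stable_boy_le hM h.1) fun e => ?_
  have h1 := h.1
  rw [← (A.boyList b).symm.injective e, M.symm_apply_apply] at h1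
  exact (lt_irrefl _ h1)

/-- By opposition of interests the girl `M' b` strictly prefers `b` to her partner in `M`, so the
search for `s_M(b)` succeeds no later than at `M' b`. -/
theorem exists_isNextGirl (hM' : M' ∈ A.stableMatchings) (h : A.Dominates M M') {b : Boy}
    (hb : M b ≠ M' b) :
    ∃ g, A.IsNextGirl M b g ∧ (A.boyList b).symm g ≤ (A.boyList b).symm (M' b) := by
  have hpref : A.GirlPrefers (M' b) b (M.symm (M' b)) := by
    have h1 := h.girl_le hM' (M' b)
    rw [M'.symm_apply_apply] at h1
    refine lt_of_le_of_ne h1 fun e => hb ?_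
    rw [← M.symm_apply_eq.1 ((A.girlList (M' b)).symm.injective e).symm]
  obtain ⟨g, hg, hmin⟩ := (InvImage.wf (A.boyList b).symm wellFounded_lt).has_min
    {g | A.GirlPrefers g b (M.symm g)} ⟨_, hpref⟩
  exact ⟨g, ⟨hg, hmin⟩, not_lt.1 (hmin _ hpref)⟩

theorem IsNextGirl.le_of_dominates {b : Boy} {g : Girl} (hg : A.IsNextGirl M b g)
    (hM' : M' ∈ A.stableMatchings) (h : A.Dominates M M') (hb : M b ≠ M' b) :
    (A.boyList b).symm g ≤ (A.boyList b).symm (M' b) := by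
  obtain ⟨g', hg', hle⟩ := exists_isNextGirl hM' h hb
  rwa [hg.unique hg']

/-- The step from `b` to the partner of `s_M(b)` stays among the boys whose partners differ: if `g`
kept her partner in `M'`, stability of `M'` would force `M' b = g`, which is absurd. -/
theorem IsNextGirl.symm_apply_ne {b : Boy} {g : Girl} (hg : A.IsNextGirl M b g)
    (hM' : M' ∈ A.stableMatchings) (h : A.Dominates M M') (hb : M b ≠ M' b) :
    M (M.symm g) ≠ M' (M.symm g) := by
  intro e
  have hle := hg.le_of_dominates hM' h hb
  have hg1 : (A.girlList g).symm b < (A.girlList g).symm (M.symm g) := hg.1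
  rw [M.apply_symm_apply] at e
  rw [← M'.symm_apply_eq.2 e] at hg1
  have e' := (A.boyList b).symm.injective (hle.antisymm (stable_boy_le hM' hg1))
  rw [M'.symm_apply_eq.2 e'] at hg1
  exact lt_irrefl _ hg1

theorem Exposed.stable (h : A.Exposed M ρ) : M ∈ A.stableMatchings := h.1

theorem Exposed.nodup (h : A.Exposed M ρ) : ρ.Nodup := h.2.2.1

theorem Exposed.apply_eq (h : A.Exposed M ρ) {p : Boy × Girl} (hp : p ∈ ρ) : M p.1 = p.2 :=
  h.2.2.2.1 p hp

theorem Exposed.exists_mem (h : A.Exposed M ρ) : ∃ p, p ∈ ρ := by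
  have := h.2.1
  induction ρ using Cycle.induction_on with
  | nil => exact absurd rfl this
  | cons a l _ => exact ⟨a, by simp⟩

theorem Exposed.chain (h : A.Exposed M ρ) :
    ρ.Chain (fun p q => A.IsNextGirl M p.1 q.2 ∧ M q.1 = q.2) := by
  refine h.2.2.2.2.imp_of_mem ?_
  rintro p hp q hq ⟨g, hg, e⟩
  have hq2 := h.apply_eq hq
  rw [M.symm_apply_eq.1 e, hq2] at hg
  exact ⟨hg, hq2⟩

theorem Exposed.mem_rotations (h : A.Exposed M ρ) : ρ ∈ A.rotations := ⟨M, h⟩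

theorem exists_eliminates [Finite Girl] (h : A.Exposed M ρ) : ∃ N, A.Eliminates ρ M N := by
  classical
  let f : Boy → Girl := fun b =>
    if hb : ∃ g, (b, M b) ∈ ρ ∧ A.IsNextGirl M b g then hb.choose else M b
  have hf1 : ∀ p ∈ ρ, ∀ g, A.IsNextGirl M p.1 g → f p.1 = g := by
    intro p hp g hg
    have hb : ∃ g, (p.1, M p.1) ∈ ρ ∧ A.IsNextGirl M p.1 g :=
      ⟨g, by rwa [h.apply_eq hp], hg⟩
    simp only [f, dif_pos hb]
    exact hb.choose_spec.2.unique hg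
  have hf2 : ∀ b, (∀ p ∈ ρ, p.1 ≠ b) → f b = M b := by
    intro b hb
    have : ¬ ∃ g, (b, M b) ∈ ρ ∧ A.IsNextGirl M b g := fun ⟨g, hp, _⟩ => hb _ hp rfl
    simp only [f, dif_neg this]
  -- A girl of the rotation is reached from the preceding pair, any other girl from her own partner.
  have hsurj : Function.Surjective f := by
    intro g
    by_cases hg : ∃ p ∈ ρ, p.1 = M.symm g
    · obtain ⟨p, hp, e⟩ := hg
      obtain ⟨q, hq, hr⟩ := h.chain.exists_mem_rel hp
      refine ⟨q.1, ?_⟩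
      rw [hf1 q hq _ hr.1, ← hr.2, e, M.apply_symm_apply]
    · push Not at hg
      exact ⟨M.symm g, by rw [hf2 _ hg, M.apply_symm_apply]⟩
  have hbij : Function.Bijective f := by
    have h1 : Function.Bijective (f ∘ M.symm) :=
      Finite.surjective_iff_bijective.1 (hsurj.comp M.symm.surjective)
    exact (Function.Bijective.of_comp_iff f M.symm.bijective).1 h1
  refine ⟨Equiv.ofBijective f hbij, h, fun p hp => ?_, hf2⟩
  obtain ⟨q, hq, hr⟩ := h.chain.exists_rel_of_mem hp
  rw [Equiv.ofBijective_apply, hf1 p hp _ hr.1]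
  exact hr.1

theorem Eliminates.exposed (h : A.Eliminates ρ M N) : A.Exposed M ρ := h.1

theorem Eliminates.isNextGirl (h : A.Eliminates ρ M N) {p : Boy × Girl} (hp : p ∈ ρ) :
    A.IsNextGirl M p.1 (N p.1) := h.2.1 p hp

theorem Eliminates.dominates (h : A.Eliminates ρ M N) : A.Dominates M N := by
  rw [dominates_iff_le]
  intro b
  by_cases hb : ∃ p ∈ ρ, p.1 = b
  · obtain ⟨p, hp, rfl⟩ := hb
    exact ((h.isNextGirl hp).lt h.exposed.stable).le
  · push Not at hb
    rw [h.2.2 b hb]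

/-- No girl loses, so the girl of a blocking pair also prefers the boy to her old partner. For a boy
of `ρ` she would come before `s_M(b)`; for any other boy the pair would block `M`. -/
theorem Eliminates.stable (h : A.Eliminates ρ M N) : N ∈ A.stableMatchings := by
  rintro b g ⟨h1, h2⟩
  have hgirl : (A.girlList g).symm (N.symm g) ≤ (A.girlList g).symm (M.symm g) := by
    by_cases hb : ∃ p ∈ ρ, p.1 = N.symm g
    · obtain ⟨p, hp, e⟩ := hb
      have := (h.isNextGirl hp).1
      rw [e, N.apply_symm_apply] at this
      exact le_of_lt this
    · push Not at hb
      have := h.2.2 _ hb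
      rw [N.apply_symm_apply] at this
      rw [M.symm_apply_eq.2 this]
  have hpref : A.GirlPrefers g b (M.symm g) := lt_of_lt_of_le h2 hgirl
  by_cases hb : ∃ p ∈ ρ, p.1 = b
  · obtain ⟨p, hp, rfl⟩ := hb
    exact (h.isNextGirl hp).2 g hpref h1
  · push Not at hb
    refine h.exposed.stable b g ⟨?_, hpref⟩
    rwa [← h.2.2 b hb]

/-- Starting at a boy whose partners differ, the steps `b ↦` partner of `s_M(b)` never leave the set
of such boys, so by finiteness they run into a cycle, which is an exposed rotation. Since `s_M(b)`
is no worse for `b` than `M' b`, its elimination does not overshoot `M'`. -/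
theorem exists_eliminates_dominates [Finite Boy] [Finite Girl] (hM : M ∈ A.stableMatchings)
    (hM' : M' ∈ A.stableMatchings) (h : A.Dominates M M') (hne : M ≠ M') :
    ∃ ρ N, A.Eliminates ρ M N ∧ A.Dominates N M' := by
  classical
  let f : Boy → Boy := fun b =>
    if hb : ∃ g, A.IsNextGirl M b g then M.symm hb.choose else b
  have hf : ∀ b, M b ≠ M' b → A.IsNextGirl M b (M (f b)) ∧ M (f b) ≠ M' (f b) := by
    intro b hb
    obtain ⟨g, hg, -⟩ := exists_isNextGirl hM' h hb
    have hex : ∃ g, A.IsNextGirl M b g := ⟨g, hg⟩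
    have e : f b = M.symm g := by
      simp only [f, dif_pos hex]
      rw [hex.choose_spec.unique hg]
    rw [e]
    exact ⟨by rwa [M.apply_symm_apply], hg.symm_apply_ne hM' h hb⟩
  obtain ⟨b, hb⟩ : ∃ b, M b ≠ M' b := by
    by_contra! hall
    exact hne (Equiv.ext hall)
  have hiter : ∀ b, M b ≠ M' b → ∀ k, M (f^[k] b) ≠ M' (f^[k] b) := by
    intro b hb k
    induction k with
    | zero => exact hb
    | succ k ih =>
      rw [Function.iterate_succ_apply']
      exact (hf _ ih).2
  obtain ⟨k, hk⟩ := Function.exists_iterate_mem_periodicPts f b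
  have hc := hiter b hb k
  generalize f^[k] b = c at hk hc
  -- The map `f` lifted to pairs, so that its orbit is a rotation.
  let F : Boy × Girl → Boy × Girl := fun p => (f p.1, M (f p.1))
  have hF : ∀ k, F^[k] (c, M c) = (f^[k] c, M (f^[k] c)) := by
    intro k
    induction k with
    | zero => rfl
    | succ k ih => rw [Function.iterate_succ_apply', ih, Function.iterate_succ_apply']
  have hper : (c, M c) ∈ Function.periodicPts F := by
    obtain ⟨m, hm, e⟩ := hk
    refine ⟨m, hm, ?_⟩
    rw [Function.IsPeriodicPt, Function.IsFixedPt, hF, e.eq]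
  have hexp : A.Exposed M (Function.periodicOrbit F (c, M c)) := by
    refine ⟨hM, ?_, Function.nodup_periodicOrbit, ?_, ?_⟩
    · rw [ne_eq, Function.periodicOrbit_eq_nil_iff_not_periodic_pt, not_not]
      exact hper
    · intro p hp
      obtain ⟨k, rfl⟩ := (Function.mem_periodicOrbit_iff hper).1 hp
      rw [hF]
    · rw [Function.periodicOrbit_chain' _ hper]
      intro k
      rw [hF, hF]
      refine ⟨_, ?_, M.symm_apply_apply _⟩
      rw [Function.iterate_succ_apply']
      exact (hf _ (hiter c hc k)).1
  obtain ⟨N, hN⟩ := exists_eliminates hexp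
  refine ⟨_, N, hN, dominates_iff_le.2 fun b => ?_⟩
  by_cases hb : ∃ p ∈ Function.periodicOrbit F (c, M c), p.1 = b
  · obtain ⟨p, hp, rfl⟩ := hb
    refine (hN.isNextGirl hp).le_of_dominates hM' h ?_
    obtain ⟨k, rfl⟩ := (Function.mem_periodicOrbit_iff hper).1 hp
    rw [hF]
    exact hiter c hc k
  · push Not at hb
    rw [hN.2.2 b hb]
    exact dominates_iff_le.1 h b

/-- A rotation is passed as a whole. In the join of `N` and `M` the boy of `p` has left his partner
in `N`; this spreads around the cycle by `IsNextGirl.symm_apply_ne`, and a boy who has left has his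
partner from `M`. -/
theorem Exposed.isNextGirl_le [Finite Girl] (h : A.Exposed N ρ) (hM : M ∈ A.stableMatchings)
    {p q : Boy × Girl} {g : Girl} (hp : p ∈ ρ)
    (hlt : (A.boyList p.1).symm p.2 < (A.boyList p.1).symm (M p.1)) (hq : q ∈ ρ)
    (hg : A.IsNextGirl N q.1 g) : (A.boyList q.1).symm g ≤ (A.boyList q.1).symm (M q.1) := by
  obtain ⟨J, hJ, hjoin⟩ := exists_isJoin h.stable hM
  have hp' : N p.1 ≠ J p.1 := by
    intro e
    have := dominates_iff_le.1 hjoin.dominates_right p.1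
    rw [← e, h.apply_eq hp] at this
    exact absurd this (not_le.2 hlt)
  have hq' : N q.1 ≠ J q.1 := by
    refine h.chain.forall_mem (P := fun q => N q.1 ≠ J q.1) ?_ hp hp' q hq
    intro q _ q' hq' hr hne
    have := hr.1.symm_apply_ne hJ hjoin.dominates_left hne
    rwa [N.symm_apply_eq.2 hr.2.symm] at this
  have hle := hg.le_of_dominates hJ hjoin.dominates_left hq'
  rcases hjoin.apply_eq_or q.1 with e | e
  · exact absurd e.symm hq'
  · rwa [e] at hle

end SMInstance

/-! ### The rotation poset and its closed sets -/

namespace SMInstance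

variable {Boy Girl : Type*} {n : ℕ} {A : SMInstance Boy Girl n} {M M' N N' : Boy ≃ Girl}
  {ρ σ τ : CyclicPairs Boy Girl} {l : List (CyclicPairs Boy Girl)}
  {C D : Set (CyclicPairs Boy Girl)}

/-- The rotations that have been eliminated on the way from the boy-optimal matching to `M`. -/
def pastRotations (A : SMInstance Boy Girl n) (M : Boy ≃ Girl) : Set (CyclicPairs Boy Girl) :=
  {ρ | ρ ∈ A.rotations ∧ ∀ p ∈ ρ, (A.boyList p.1).symm p.2 < (A.boyList p.1).symm (M p.1)}

theorem pastRotations_subset (A : SMInstance Boy Girl n) (M : Boy ≃ Girl) :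
    A.pastRotations M ⊆ A.rotations := fun _ h => h.1

theorem pastRotations_mono (h : A.Dominates M M') : A.pastRotations M ⊆ A.pastRotations M' :=
  fun _ hρ => ⟨hρ.1, fun p hp => (hρ.2 p hp).trans_le (dominates_iff_le.1 h p.1)⟩

theorem Exposed.notMem_pastRotations (h : A.Exposed M ρ) : ρ ∉ A.pastRotations M := by
  intro hρ
  obtain ⟨p, hp⟩ := h.exists_mem
  have := hρ.2 p hp
  rw [h.apply_eq hp] at this
  exact lt_irrefl _ this

theorem Eliminates.mem_pastRotations (h : A.Eliminates ρ M N) : ρ ∈ A.pastRotations N := by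
  refine ⟨h.exposed.mem_rotations, fun p hp => ?_⟩
  have := (h.isNextGirl hp).lt h.exposed.stable
  rwa [h.exposed.apply_eq hp] at this

theorem IsMeet.pastRotations_eq (h : A.IsMeet M M' N) :
    A.pastRotations N = A.pastRotations M ∩ A.pastRotations M' := by
  refine Set.Subset.antisymm (Set.subset_inter (pastRotations_mono h.dominates_left)
    (pastRotations_mono h.dominates_right)) fun ρ hρ => ⟨hρ.1.1, fun p hp => ?_⟩
  rcases h.apply_eq_or p.1 with e | e <;> rw [e]
  exacts [hρ.1.2 p hp, hρ.2.2 p hp]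

theorem EliminatesSeq.dominates (h : A.EliminatesSeq l M N) : A.Dominates M N := by
  induction l generalizing M with
  | nil => exact h ▸ Dominates.refl A M
  | cons ρ l ih =>
    obtain ⟨K, hK, h⟩ := h
    exact hK.dominates.trans (ih h)

theorem pastRotations_eq_empty (h : A.IsBoyOptimalIn A.stableMatchings M) :
    A.pastRotations M = ∅ := by
  refine Set.eq_empty_of_forall_notMem fun ρ hρ => ?_
  obtain ⟨N, hN⟩ := hρ.1
  exact hN.notMem_pastRotations (pastRotations_mono (h.2 N hN.stable) hρ)

theorem Precedes.refl (A : SMInstance Boy Girl n) (ρ : CyclicPairs Boy Girl) :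
    A.Precedes ρ ρ := Or.inl rfl

theorem EliminatesSeq.notMem_pastRotations (h : A.EliminatesSeq l M N) (hρ : ρ ∈ l) :
    ρ ∉ A.pastRotations M := by
  induction l generalizing M with
  | nil => simp at hρ
  | cons σ l ih =>
    obtain ⟨K, hK, h⟩ := h
    rcases List.mem_cons.1 hρ with rfl | hρ
    · exact hK.exposed.notMem_pastRotations
    · exact fun h' => ih h hρ (pastRotations_mono hK.dominates h')

theorem EliminatesSeq.nodup (h : A.EliminatesSeq l M N) : l.Nodup := by
  induction l generalizing M with
  | nil => exact List.nodup_nil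
  | cons σ l ih =>
    obtain ⟨K, hK, h⟩ := h
    exact List.nodup_cons.2 ⟨fun h' => h.notMem_pastRotations h' hK.mem_pastRotations, ih h⟩

variable [Finite Girl]

/-- A single pair decides membership, because rotations are passed as a whole. -/
theorem mem_pastRotations_of_lt (hρ : ρ ∈ A.rotations) (hM : M ∈ A.stableMatchings)
    {p : Boy × Girl} (hp : p ∈ ρ)
    (hlt : (A.boyList p.1).symm p.2 < (A.boyList p.1).symm (M p.1)) : ρ ∈ A.pastRotations M := by
  refine ⟨hρ, fun q hq => ?_⟩
  obtain ⟨N, hN⟩ := hρ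
  obtain ⟨q', -, hr⟩ := hN.chain.exists_rel_of_mem hq
  have := hr.1.lt hN.stable
  rw [hN.apply_eq hq] at this
  exact this.trans_le (hN.isNextGirl_le hM hp hlt hq hr.1)

theorem le_of_notMem_pastRotations (hρ : ρ ∈ A.rotations) (hM : M ∈ A.stableMatchings)
    (h : ρ ∉ A.pastRotations M) {p : Boy × Girl} (hp : p ∈ ρ) :
    (A.boyList p.1).symm (M p.1) ≤ (A.boyList p.1).symm p.2 :=
  not_lt.1 fun hlt => h (mem_pastRotations_of_lt hρ hM hp hlt)

/-- A boy of `σ` must move between `M` and `N`, so he is in `ρ`. If his pair in `ρ` came before his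
pair in `σ`, then `ρ` would be past where `σ` is exposed, and `N` would not carry him beyond his
pair in `σ`. So the pairs of `σ` lie in `ρ`; the next girls agree too, and a cycle is determined by
its successor relation and one member. -/
theorem Eliminates.eq_of_mem_pastRotations (h : A.Eliminates ρ M N) (hσ : σ ∈ A.pastRotations N)
    (hσ' : σ ∉ A.pastRotations M) : σ = ρ := by
  obtain ⟨hσr, hlt⟩ := hσ
  obtain ⟨K, hK⟩ := id hσr
  obtain ⟨K', hKK'⟩ := exists_eliminates hK
  have hM := h.exposed.stable
  have hsub : ∀ p ∈ σ, p ∈ ρ := by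
    intro p hp
    have h1 := le_of_notMem_pastRotations hσr hM hσ' hp
    have h2 := hlt p hp
    have hb : ∃ q ∈ ρ, q.1 = p.1 := by
      by_contra! hb
      rw [h.2.2 _ hb] at h2
      exact absurd h1 (not_le.2 h2)
    obtain ⟨⟨b, g⟩, hq, rfl⟩ := hb
    have hMb := h.exposed.apply_eq hq
    dsimp only at hMb
    suffices e : g = p.2 by rwa [e] at hq
    by_contra hne
    have hlt' : (A.boyList p.1).symm g < (A.boyList p.1).symm (K p.1) := by
      rw [hMb] at h1
      rw [hK.apply_eq hp]
      exact lt_of_le_of_ne h1 fun e => hne ((A.boyList p.1).symm.injective e)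
    have := h.exposed.isNextGirl_le hK.stable hq hlt' hq (h.isNextGirl hq)
    dsimp only at this
    rw [hK.apply_eq hp] at this
    exact absurd this (not_le.2 h2)
  have hchain : σ.Chain (fun p q => A.IsNextGirl M p.1 q.2 ∧ M q.1 = q.2) := by
    refine hK.chain.imp_of_mem fun p hp q hq hr => ⟨?_, h.exposed.apply_eq (hsub q hq)⟩
    have hp' := hsub p hp
    -- Passing `σ` in `N` and passing `ρ` in `K'` bound the two next girls by each other.
    have h1 := hK.isNextGirl_le h.stable hp (hlt p hp) hp hr.1
    have h2 : (A.boyList p.1).symm (N p.1) ≤ (A.boyList p.1).symm (K' p.1) := by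
      refine h.exposed.isNextGirl_le hKK'.stable hp' ?_ hp' (h.isNextGirl hp')
      exact hKK'.mem_pastRotations.2 p hp
    rw [(hKK'.isNextGirl hp).unique hr.1] at h2
    rw [(A.boyList p.1).symm.injective (h1.antisymm h2)]
    exact h.isNextGirl hp'
  obtain ⟨p, hp⟩ := hK.exists_mem
  refine Cycle.eq_of_chain_of_mem hchain h.exposed.chain hK.nodup h.exposed.nodup ?_ hp (hsub p hp)
  rintro a ⟨b, g⟩ ⟨b', g'⟩ ⟨h1, e1⟩ ⟨h2, e2⟩
  obtain rfl : g = g' := h1.unique h2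
  obtain rfl : b = b' := M.injective (e1.trans e2.symm)
  rfl

theorem Eliminates.pastRotations_eq (h : A.Eliminates ρ M N) :
    A.pastRotations N = insert ρ (A.pastRotations M) := by
  refine Set.Subset.antisymm (fun σ hσ => ?_)
    (Set.insert_subset h.mem_pastRotations (pastRotations_mono h.dominates))
  by_cases hσ' : σ ∈ A.pastRotations M
  · exact Or.inr hσ'
  · exact Or.inl (h.eq_of_mem_pastRotations hσ hσ')

theorem IsJoin.pastRotations_eq (hM : M ∈ A.stableMatchings) (hM' : M' ∈ A.stableMatchings)
    (h : A.IsJoin M M' N) :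
    A.pastRotations N = A.pastRotations M ∪ A.pastRotations M' := by
  refine Set.Subset.antisymm ?_ (Set.union_subset (pastRotations_mono h.dominates_left)
    (pastRotations_mono h.dominates_right))
  rintro ρ ⟨hρ, hlt⟩
  obtain ⟨K, hK⟩ := id hρ
  obtain ⟨p, hp⟩ := hK.exists_mem
  have := hlt p hp
  rcases h.apply_eq_or p.1 with e | e <;> rw [e] at this
  exacts [Or.inl (mem_pastRotations_of_lt hρ hM hp this),
    Or.inr (mem_pastRotations_of_lt hρ hM' hp this)]

/-- If the meet differed from `M`, a rotation exposed in the meet would be past in `M`, hence in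
`M'`, hence in the meet itself. -/
theorem pastRotations_subset_iff [Finite Boy] (hM : M ∈ A.stableMatchings)
    (hM' : M' ∈ A.stableMatchings) :
    A.pastRotations M ⊆ A.pastRotations M' ↔ A.Dominates M M' := by
  refine ⟨fun hsub => ?_, pastRotations_mono⟩
  obtain ⟨N, hN, hmeet⟩ := exists_isMeet hM hM'
  by_cases hne : N = M
  · exact hne ▸ hmeet.dominates_right
  obtain ⟨ρ, K, hρ, hK⟩ := exists_eliminates_dominates hN hM hmeet.dominates_left hne
  have h1 := pastRotations_mono hK hρ.mem_pastRotations
  refine absurd ?_ hρ.exposed.notMem_pastRotations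
  rw [hmeet.pastRotations_eq]
  exact ⟨h1, hsub h1⟩

theorem pastRotations_injOn [Finite Boy] : Set.InjOn A.pastRotations A.stableMatchings :=
  fun _ hM _ hM' e => ((pastRotations_subset_iff hM hM').1 e.subset).antisymm
    ((pastRotations_subset_iff hM' hM).1 e.symm.subset)

theorem EliminatesSeq.pastRotations_eq (h : A.EliminatesSeq l M N) :
    A.pastRotations N = A.pastRotations M ∪ {ρ | ρ ∈ l} := by
  induction l generalizing M with
  | nil => simp [show M = N from h]
  | cons ρ l ih =>
    obtain ⟨K, hK, h⟩ := h
    rw [ih h, hK.pastRotations_eq]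
    ext σ
    simp only [Set.mem_union, Set.mem_insert_iff, Set.mem_ofPred_eq, List.mem_cons]
    tauto

theorem EliminatesSeq.mem_iff (h : A.EliminatesSeq l M N) :
    ρ ∈ l ↔ ρ ∈ A.pastRotations N ∧ ρ ∉ A.pastRotations M := by
  rw [h.pastRotations_eq]
  have := h.notMem_pastRotations (ρ := ρ)
  simp only [Set.mem_union, Set.mem_ofPred_eq]
  tauto

variable [Finite Boy]

theorem exists_eliminatesSeq (hM : M ∈ A.stableMatchings) (hM' : M' ∈ A.stableMatchings)
    (h : A.Dominates M M') : ∃ l, A.EliminatesSeq l M M' := by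
  have := finite_matchings Boy Girl
  have hwf : WellFounded fun K K' : Boy ≃ Girl => A.Dominates K' K ∧ K' ≠ K := by
    have : IsTrans (Boy ≃ Girl) fun K K' => A.Dominates K' K ∧ K' ≠ K :=
      ⟨fun _ _ _ h1 h2 => ⟨h2.1.trans h1.1, fun e => h1.2 (h1.1.antisymm (e ▸ h2.1))⟩⟩
    have : Std.Irrefl fun K K' : Boy ≃ Girl => A.Dominates K' K ∧ K' ≠ K :=
      ⟨fun _ h => h.2 rfl⟩
    exact Finite.wellFounded_of_trans_of_irrefl _
  induction M using hwf.induction with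
  | h M ih =>
    by_cases hne : M = M'
    · exact ⟨[], hne⟩
    obtain ⟨ρ, N, hρ, hN⟩ := exists_eliminates_dominates hM hM' h hne
    obtain ⟨l, hl⟩ := ih N ⟨hρ.dominates, fun e => hρ.exposed.notMem_pastRotations
      (e ▸ hρ.mem_pastRotations)⟩ hρ.stable hN
    exact ⟨ρ :: l, N, hρ, hl⟩

theorem exists_boyOptimal (hne : A.stableMatchings.Nonempty) :
    ∃ M, A.IsBoyOptimalIn A.stableMatchings M :=
  exists_least subset_rfl hne fun _ _ _ _ _ hN _ => hN

/-- The order of the rotation poset in terms of the sets of eliminated rotations. -/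
theorem precedes_iff (hσ : σ ∈ A.rotations) :
    A.Precedes ρ σ ↔
      ∀ M ∈ A.stableMatchings, σ ∈ A.pastRotations M → ρ ∈ A.pastRotations M := by
  obtain ⟨K, hK⟩ := id hσ
  obtain ⟨M₀, hM₀⟩ := exists_boyOptimal ⟨K, hK.stable⟩
  have hM₀e := pastRotations_eq_empty hM₀
  constructor
  · rintro (rfl | h) M hM hσM
    · exact hσM
    obtain ⟨l, hl⟩ := exists_eliminatesSeq hM₀.1 hM (hM₀.2 M hM)
    have hσl : σ ∈ l := by rw [hl.mem_iff, hM₀e]; exact ⟨hσM, by simp⟩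
    -- Follow the path until `σ` is exposed; any path from `M₀` to that point already contains `ρ`.
    suffices key : ∀ N, N ∈ A.stableMatchings → ∀ l, A.EliminatesSeq l N M → σ ∈ l →
        ρ ∈ A.pastRotations M from key M₀ hM₀.1 l hl hσl
    intro N hN l hl hσl
    induction l generalizing N with
    | nil => simp at hσl
    | cons τ l ih =>
      obtain ⟨N', hN', hl'⟩ := hl
      rcases List.mem_cons.1 hσl with rfl | hσl'
      · obtain ⟨l₀, hl₀⟩ := exists_eliminatesSeq hM₀.1 hN (hM₀.2 N hN)
        have := h M₀ hM₀ l₀ N hl₀ hN'.exposed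
        exact pastRotations_mono (hN'.dominates.trans hl'.dominates) (hl₀.mem_iff.1 this).1
      · exact ih N' hN'.stable hl' hσl'
  · intro h
    refine or_iff_not_imp_left.2 fun hne M₁ hM₁ l M hl hM => ?_
    rw [hl.mem_iff, pastRotations_eq_empty hM₁]
    obtain ⟨N, hN⟩ := exists_eliminates hM
    have := h N hN.stable hN.mem_pastRotations
    rw [hN.pastRotations_eq] at this
    exact ⟨this.resolve_left hne, by simp⟩

theorem Precedes.trans (hσ : σ ∈ A.rotations) (hτ : τ ∈ A.rotations) (h : A.Precedes ρ σ)
    (h' : A.Precedes σ τ) : A.Precedes ρ τ := by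
  rw [precedes_iff hσ] at h
  rw [precedes_iff hτ] at *
  exact fun M hM hτM => h M hM (h' M hM hτM)

theorem Precedes.antisymm (hρ : ρ ∈ A.rotations) (hσ : σ ∈ A.rotations) (h : A.Precedes ρ σ)
    (h' : A.Precedes σ ρ) : ρ = σ := by
  by_contra hne
  rw [precedes_iff hσ] at h
  rw [precedes_iff hρ] at h'
  obtain ⟨M, hM⟩ := hσ
  obtain ⟨N, hN⟩ := exists_eliminates hM
  have h1 := h N hN.stable hN.mem_pastRotations
  rw [hN.pastRotations_eq] at h1
  exact hM.notMem_pastRotations (h' M hM.stable (h1.resolve_left hne))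

theorem isClosedIn_pastRotations (hM : M ∈ A.stableMatchings) :
    A.IsClosedIn A.rotations (A.pastRotations M) :=
  ⟨pastRotations_subset A M, fun _ hσ _ _ h => (precedes_iff hσ.1).1 h M hM hσ⟩

/-- The boy-optimal one of the stable matchings for which `σ` has been eliminated. -/
theorem exists_pastRotations_eq_principal (hσ : σ ∈ A.rotations) :
    ∃ M ∈ A.stableMatchings, A.pastRotations M = {ρ | ρ ∈ A.rotations ∧ A.Precedes ρ σ} := by
  obtain ⟨K, hK⟩ := id hσ
  obtain ⟨K', hK'⟩ := exists_eliminates hK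
  obtain ⟨M, hM, hle⟩ := exists_least (A := A)
    (L := {M | M ∈ A.stableMatchings ∧ σ ∈ A.pastRotations M}) (fun _ h => h.1)
    ⟨K', hK'.stable, hK'.mem_pastRotations⟩ (fun M hM M' hM' N hN h =>
      ⟨hN, by rw [h.pastRotations_eq]; exact ⟨hM.2, hM'.2⟩⟩)
  refine ⟨M, hM.1, Set.Subset.antisymm (fun ρ hρ => ⟨hρ.1, (precedes_iff hσ).2 ?_⟩) ?_⟩
  · exact fun N hN hσN => pastRotations_mono (hle N ⟨hN, hσN⟩) hρ
  · exact fun ρ hρ => (precedes_iff hσ).1 hρ.2 M hM.1 hM.2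

/-- The closed sets of rotations are the sets of eliminated rotations of the stable matchings. -/
theorem exists_pastRotations_eq (hne : A.stableMatchings.Nonempty)
    (hC : A.IsClosedIn A.rotations C) : ∃ M ∈ A.stableMatchings, A.pastRotations M = C := by
  obtain ⟨M₀, hM₀⟩ := exists_boyOptimal hne
  -- The join of everything with past inside `C`. It exhausts `C`, since `C` contains the principal
  -- closed set of each of its members.
  obtain ⟨M, hM, hge⟩ := exists_greatest (A := A)
    (L := {M | M ∈ A.stableMatchings ∧ A.pastRotations M ⊆ C}) (fun _ h => h.1)
    ⟨M₀, hM₀.1, by simp [pastRotations_eq_empty hM₀]⟩ (fun M hM M' hM' N hN h =>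
      ⟨hN, by rw [h.pastRotations_eq hM.1 hM'.1]; exact Set.union_subset hM.2 hM'.2⟩)
  refine ⟨M, hM.1, Set.Subset.antisymm hM.2 fun σ hσ => ?_⟩
  obtain ⟨N, hN, e⟩ := exists_pastRotations_eq_principal (hC.1 hσ)
  have hNC : A.pastRotations N ⊆ C := by
    rw [e]
    exact fun ρ hρ => hC.2 σ hσ ρ hρ.1 hρ.2
  refine pastRotations_mono (hge N ⟨hN, hNC⟩) ?_
  rw [e]
  exact ⟨hC.1 hσ, Precedes.refl A σ⟩

theorem EliminatesSeq.pairwise (h : A.EliminatesSeq l M N) :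
    l.Pairwise fun ρ σ => ¬ A.Precedes σ ρ := by
  induction l generalizing M with
  | nil => exact List.Pairwise.nil
  | cons ρ l ih =>
    obtain ⟨K, hK, h⟩ := h
    refine List.pairwise_cons.2 ⟨fun σ hσ hσρ => ?_, ih h⟩
    exact h.notMem_pastRotations hσ
      ((precedes_iff hK.exposed.mem_rotations).1 hσρ K hK.stable hK.mem_pastRotations)

theorem eliminates_of_pastRotations_eq (hM : M ∈ A.stableMatchings) (hN : N ∈ A.stableMatchings)
    (hρ : ρ ∉ A.pastRotations M) (h : A.pastRotations N = insert ρ (A.pastRotations M)) :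
    A.Eliminates ρ M N := by
  have hd : A.Dominates M N := (pastRotations_subset_iff hM hN).1 (h ▸ Set.subset_insert _ _)
  have hne : M ≠ N := fun e => hρ (by rw [e, h]; exact Set.mem_insert _ _)
  obtain ⟨σ, K, hσ, hK⟩ := exists_eliminates_dominates hM hN hd hne
  have h1 := pastRotations_mono hK hσ.mem_pastRotations
  rw [h] at h1
  obtain rfl := h1.resolve_right hσ.exposed.notMem_pastRotations
  rwa [← pastRotations_injOn hσ.stable hN (hσ.pastRotations_eq.trans h.symm)]

/-- Induction along the order: the predecessors of the first rotation lie in the past of `N`, and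
none is later in the list, so adding it to the past of `M` leaves a closed set, that is, a stable
matching one elimination away. -/
theorem generates_of_pastRotations_eq (hM : M ∈ A.stableMatchings) (hN : N ∈ A.stableMatchings)
    (hdisj : Disjoint (A.pastRotations M) C) (h : A.pastRotations N = A.pastRotations M ∪ C) :
    A.Generates M C N := by
  have hd : A.Dominates M N :=
    (pastRotations_subset_iff hM hN).1 (h ▸ Set.subset_union_left)
  refine ⟨?_, ?_⟩
  · obtain ⟨l, hl⟩ := exists_eliminatesSeq hM hN hd
    refine ⟨l, hl.nodup, fun ρ => ?_, hl.pairwise⟩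
    rw [hl.mem_iff, h]
    have : ρ ∈ C → ρ ∉ A.pastRotations M := fun h => Set.disjoint_right.1 hdisj h
    simp only [Set.mem_union]
    tauto
  · intro l hl
    induction l generalizing M C with
    | nil =>
      have : C = ∅ := Set.eq_empty_of_forall_notMem fun ρ hρ => by simpa using (hl.2.1 ρ).2 hρ
      rw [this, Set.union_empty] at h
      exact pastRotations_injOn hM hN h.symm
    | cons ρ l ih =>
      obtain ⟨hnd, hmem, hpw⟩ := hl
      rw [List.nodup_cons] at hnd
      rw [List.pairwise_cons] at hpw
      have hρC : ρ ∈ C := (hmem ρ).1 List.mem_cons_self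
      have hρN : ρ ∈ A.pastRotations N := by rw [h]; exact Or.inr hρC
      have hρM : ρ ∉ A.pastRotations M := Set.disjoint_right.1 hdisj hρC
      have hcl : A.IsClosedIn A.rotations (insert ρ (A.pastRotations M)) := by
        refine ⟨Set.insert_subset hρN.1 (pastRotations_subset A M), ?_⟩
        rintro σ (rfl | hσ) τ hτ hτσ
        · have hτN := (isClosedIn_pastRotations hN).2 _ hρN τ hτ hτσ
          rw [h] at hτN
          rcases hτN with hτM | hτC
          · exact Or.inr hτM
          · rcases List.mem_cons.1 ((hmem τ).2 hτC) with e | hτl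
            · exact Or.inl e
            · exact absurd hτσ (hpw.1 τ hτl)
        · exact Or.inr ((isClosedIn_pastRotations hM).2 σ hσ τ hτ hτσ)
      obtain ⟨K, hK, e⟩ := exists_pastRotations_eq ⟨M, hM⟩ hcl
      have hKd : A.Dominates K N := (pastRotations_subset_iff hK hN).1 <| by
        rw [e, h]
        exact Set.insert_subset (Or.inr hρC) Set.subset_union_left
      refine ⟨K, eliminates_of_pastRotations_eq hM hK hρM e,
        ih (C := C \ {ρ}) hK ?_ ?_ hKd ⟨hnd.2, fun σ => ?_, hpw.2⟩⟩
      · rw [e, Set.disjoint_left]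
        rintro σ (rfl | hσ) hσ'
        · exact hσ'.2 rfl
        · exact Set.disjoint_left.1 hdisj hσ hσ'.1
      · rw [e, h]
        ext σ
        simp only [Set.mem_union, Set.mem_insert_iff, Set.mem_sdiff, Set.mem_singleton_iff]
        have : σ = ρ → σ ∈ C := fun e => e ▸ hρC
        tauto
      · rw [Set.mem_sdiff, ← hmem, List.mem_cons, Set.mem_singleton_iff]
        have : σ = ρ → σ ∉ l := fun e => e ▸ hnd.1
        tauto

end SMInstance

/-! ### The effect of an upward shift on a list -/

/-- Here `z` is the moved entry and `p` its new position. Phrasing both halves by old positions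
makes the blocking condition a threshold in the old list; the second half also covers entries that
`z` preceded before. -/
theorem IsUpwardShift.exists_moved {n : ℕ} {X : Type*} {l l' : Fin n ≃ X}
    (h : IsUpwardShift l l') : ∃ p : Fin n, ∃ z : X,
      (∀ x y, l'.symm x < l'.symm y → ¬ l.symm x < l.symm y → x = z ∧ p ≤ l.symm y) ∧
      ∀ y, y ≠ z → p ≤ l.symm y → l'.symm z < l'.symm y := by
  obtain ⟨p, q, hpq, hq, hmid, hout⟩ := h
  have h1 : l'.symm (l q) = p := by rw [Equiv.symm_apply_eq, hq]
  have h2 : ∀ i : Fin n, p ≤ i → i < q → (l'.symm (l i) : ℕ) = i + 1 := by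
    intro i hpi hiq
    have hlt : (i : ℕ) + 1 < n := lt_of_le_of_lt (Nat.succ_le_of_lt hiq) q.2
    rw [← hmid i ⟨i + 1, hlt⟩ hpi hiq rfl, Equiv.symm_apply_apply]
  have h3 : ∀ i : Fin n, i < p ∨ q < i → l'.symm (l i) = i := by
    intro i hi
    rw [← hout i hi, Equiv.symm_apply_apply]
  have hpos : ∀ i : Fin n, (i = q ∧ l'.symm (l i) = p) ∨
      (p ≤ i ∧ i < q ∧ (l'.symm (l i) : ℕ) = i + 1) ∨
      ((i < p ∨ q < i) ∧ l'.symm (l i) = i) := by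
    intro i
    rcases lt_trichotomy i q with hi | rfl | hi
    · rcases lt_or_ge i p with hi' | hi'
      · exact Or.inr (Or.inr ⟨Or.inl hi', h3 i (Or.inl hi')⟩)
      · exact Or.inr (Or.inl ⟨hi', hi, h2 i hi' hi⟩)
    · exact Or.inl ⟨rfl, h1⟩
    · exact Or.inr (Or.inr ⟨Or.inr hi, h3 i (Or.inr hi)⟩)
  refine ⟨p, l q, fun x y => ?_, fun y => ?_⟩
  · obtain ⟨i, rfl⟩ := l.surjective x
    obtain ⟨j, rfl⟩ := l.surjective y
    rw [l.symm_apply_apply, l.symm_apply_apply, l.injective.eq_iff]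
    have hi := hpos i
    have hj := hpos j
    simp only [Fin.lt_def, Fin.le_def, Fin.ext_iff] at *
    omega
  · obtain ⟨j, rfl⟩ := l.surjective y
    rw [l.symm_apply_apply, ne_eq, l.injective.eq_iff, h1]
    have hj := hpos j
    simp only [Fin.lt_def, Fin.le_def, Fin.ext_iff] at *
    omega

/-! ### Prime filters and the lost matchings -/

namespace SMInstance

variable {Boy Girl : Type*} {n : ℕ} {A B : SMInstance Boy Girl n} {M M' N N' : Boy ≃ Girl}
  {ρ σ τ : CyclicPairs Boy Girl} {l : List (CyclicPairs Boy Girl)}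
  {C D : Set (CyclicPairs Boy Girl)} {L U V : Set (Boy ≃ Girl)}

/-- `U` cuts out a prime filter of the lattice of stable matchings, ordered from the boy-optimal
matching to the boy-pessimal one. -/
structure IsPrimeFilter (A : SMInstance Boy Girl n) (U : Set (Boy ≃ Girl)) : Prop where
  mono : ∀ M ∈ A.stableMatchings, ∀ N ∈ A.stableMatchings, A.Dominates M N → M ∈ U → N ∈ U
  meet : ∀ M ∈ U, ∀ M' ∈ U, ∀ N, A.IsMeet M M' N → N ∈ U
  join : ∀ M, M ∉ U → ∀ M', M' ∉ U → ∀ N, A.IsJoin M M' N → N ∉ U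

/-- Meets and joins give an agent one of the two partners, so any threshold on one agent's partner
is prime. For girls the direction reverses, by opposition of interests. -/
theorem isPrimeFilter_boy (A : SMInstance Boy Girl n) (b : Boy) {S : Set (Fin n)}
    (hS : IsUpperSet S) : A.IsPrimeFilter {M | (A.boyList b).symm (M b) ∈ S} where
  mono _ _ _ _ h hM := hS (dominates_iff_le.1 h b) hM
  meet M hM M' hM' N h := by
    rcases h.apply_eq_or b with e | e <;> rw [Set.mem_ofPred_eq, e]
    exacts [hM, hM']
  join M hM M' hM' N h := by
    rcases h.apply_eq_or b with e | e <;> rw [Set.mem_ofPred_eq, e]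
    exacts [hM, hM']

theorem isPrimeFilter_girl (A : SMInstance Boy Girl n) (g : Girl) {S : Set (Fin n)}
    (hS : IsLowerSet S) : A.IsPrimeFilter {M | (A.girlList g).symm (M.symm g) ∈ S} where
  mono _ _ _ hN h hM := hS (h.girl_le hN g) hM
  meet M hM M' hM' N h := by
    rcases h.symm_apply_eq_or g with e | e <;> rw [Set.mem_ofPred_eq, e]
    exacts [hM, hM']
  join M hM M' hM' N h := by
    rcases h.symm_apply_eq_or g with e | e <;> rw [Set.mem_ofPred_eq, e]
    exacts [hM, hM']

/-- A shift loses the stable matchings that lie in one prime filter and not in another one. -/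
theorem exists_isPrimeFilter_lostMatchings (h : A.IsGirlShift B ∨ A.IsBoyShift B) :
    ∃ U V, A.IsPrimeFilter U ∧ A.IsPrimeFilter V ∧
      A.lostMatchings B = {M | M ∈ A.stableMatchings ∧ M ∈ U ∧ M ∉ V} := by
  rcases h with ⟨hb, g, hg, hg'⟩ | ⟨hg, b, hb, hb'⟩
  · obtain ⟨p, b, h1, h2⟩ := hg.exists_moved
    -- `U`: `b` is worse off than with `g`. `V`: the partner of `g` stands before `p`.
    refine ⟨_, _, isPrimeFilter_boy A b (isUpperSet_Ioi ((A.boyList b).symm g)),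
      isPrimeFilter_girl A g (isLowerSet_Iio p), Set.ext fun M => and_congr_right fun hM => ?_⟩
    simp only [Set.mem_ofPred_eq, Set.mem_Ioi, Set.mem_Iio, not_lt]
    constructor
    · intro hMB
      simp only [stableMatchings, Set.mem_ofPred_eq, not_forall, not_not] at hMB
      obtain ⟨b', g', hbo, hgi⟩ := hMB
      rw [BoyPrefers, hb] at hbo
      obtain rfl : g' = g := by
        by_contra hne
        rw [GirlPrefers, hg' g' hne] at hgi
        exact hM b' g' ⟨hbo, hgi⟩
      obtain ⟨rfl, hp⟩ := h1 _ _ hgi fun hlt => hM b' g' ⟨hbo, hlt⟩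
      exact ⟨hbo, hp⟩
    · rintro ⟨hbo, hp⟩ hMB
      refine hMB b g ⟨?_, h2 _ ?_ hp⟩
      · rw [BoyPrefers, hb]
        exact hbo
      · rintro rfl
        rw [M.apply_symm_apply] at hbo
        exact lt_irrefl _ hbo
  · obtain ⟨p, g, h1, h2⟩ := hb.exists_moved
    -- `U`: the partner of `b` stands at `p` or later. `V`: `g` does not prefer `b` to her partner.
    refine ⟨_, _, isPrimeFilter_boy A b (isUpperSet_Ici p),
      isPrimeFilter_girl A g (isLowerSet_Iic ((A.girlList g).symm b)),
      Set.ext fun M => and_congr_right fun hM => ?_⟩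
    simp only [Set.mem_ofPred_eq, Set.mem_Ici, Set.mem_Iic, not_le]
    constructor
    · intro hMB
      simp only [stableMatchings, Set.mem_ofPred_eq, not_forall, not_not] at hMB
      obtain ⟨b', g', hbo, hgi⟩ := hMB
      rw [GirlPrefers, hg] at hgi
      obtain rfl : b' = b := by
        by_contra hne
        rw [BoyPrefers, hb' b' hne] at hbo
        exact hM b' g' ⟨hbo, hgi⟩
      obtain ⟨rfl, hp⟩ := h1 _ _ hbo fun hlt => hM b' g' ⟨hlt, hgi⟩
      exact ⟨hp, hgi⟩
    · rintro ⟨hp, hgi⟩ hMB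
      refine hMB b g ⟨h2 _ ?_ hp, ?_⟩
      · rintro rfl
        rw [M.symm_apply_apply] at hgi
        exact lt_irrefl _ hgi
      · rw [GirlPrefers, hg]
        exact hgi

theorem EliminatesSeq.exists_crossing {P : (Boy ≃ Girl) → Prop} (h : A.EliminatesSeq l M N)
    (hM : P M) (hN : ¬ P N) :
    ∃ ρ ∈ l, ∃ K K', A.Eliminates ρ K K' ∧ P K ∧ ¬ P K' := by
  induction l generalizing M with
  | nil => exact absurd (show M = N from h ▸ rfl) fun e => hN (e ▸ hM)
  | cons ρ l ih =>
    obtain ⟨K, hK, h⟩ := h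
    by_cases hP : P K
    · obtain ⟨σ, hσ, h⟩ := ih h hP
      exact ⟨σ, List.mem_cons_of_mem _ hσ, h⟩
    · exact ⟨ρ, List.mem_cons_self, M, K, hK, hM, hP⟩

variable [Finite Boy] [Finite Girl]

/-- A prime filter is entered by the elimination of just one rotation. -/
theorem IsPrimeFilter.mem_iff (hU : A.IsPrimeFilter U) (h : A.Eliminates ρ M M') (hM : M ∉ U)
    (hM' : M' ∈ U) (hN : N ∈ A.stableMatchings) : N ∈ U ↔ ρ ∈ A.pastRotations N := by
  constructor
  · intro hNU
    by_contra hρ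
    -- Without `ρ` in the past of `N`, the meet of `N` and `M'` dominates `M` and would pull `M`
    -- into `U`.
    obtain ⟨K, hK, hmeet⟩ := exists_isMeet hN h.stable
    refine hM (hU.mono K hK M h.exposed.stable ?_ (hU.meet _ hNU _ hM' _ hmeet))
    rw [← pastRotations_subset_iff hK h.exposed.stable, hmeet.pastRotations_eq,
      h.pastRotations_eq]
    rintro σ ⟨hσ, rfl | hσ'⟩
    exacts [absurd hσ hρ, hσ']
  · intro hρ
    by_contra hNU
    -- The join of `M` and `N` is dominated by `M'`, so it lies in `U` although neither `M` nor `N`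
    -- does.
    obtain ⟨J, hJ, hjoin⟩ := exists_isJoin h.exposed.stable hN
    refine hU.join _ hM _ hNU _ hjoin (hU.mono M' h.stable J hJ ?_ hM')
    rw [← pastRotations_subset_iff h.stable hJ, hjoin.pastRotations_eq h.exposed.stable hN,
      h.pastRotations_eq]
    exact Set.insert_subset (Or.inr hρ) Set.subset_union_left

theorem IsPrimeFilter.eq_of_crossing (hU : A.IsPrimeFilter U) (h : A.Eliminates ρ M M')
    (hM : M ∉ U) (hM' : M' ∈ U) (h' : A.Eliminates σ N N') (hN : N ∉ U) (hN' : N' ∈ U) :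
    ρ = σ := by
  have h1 := (hU.mem_iff h hM hM' h'.stable).1 hN'
  rw [h'.pastRotations_eq] at h1
  exact h1.resolve_right fun h2 => hN ((hU.mem_iff h hM hM' h'.exposed.stable).2 h2)

/-- As `K` and `P` are disjoint, `C` can be recovered from `K ∪ C`. Every clause thus becomes a set
identity about pasts; the preimage of `N` is its past without `K`. -/
theorem isRotationPosetVia_of_pastRotations_eq {P K : Set (CyclicPairs Boy Girl)}
    {Φ : Set (CyclicPairs Boy Girl) → (Boy ≃ Girl)} (hP : P ⊆ A.rotations)
    (hM : M ∈ A.stableMatchings) (hMK : A.pastRotations M = K) (hPK : Disjoint K P)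
    (hL : L = {N | N ∈ A.stableMatchings ∧ K ⊆ A.pastRotations N ∧ A.pastRotations N ⊆ K ∪ P})
    (hΦ : ∀ C, A.IsClosedIn P C → Φ C ∈ A.stableMatchings ∧ A.pastRotations (Φ C) = K ∪ C) :
    A.IsRotationPosetVia P M L Φ := by
  have hdisj : ∀ C, A.IsClosedIn P C → Disjoint K C := fun C hC => hPK.mono_right hC.1
  have hsub : ∀ C D, A.IsClosedIn P C → (K ∪ C ⊆ K ∪ D ↔ C ⊆ D) := by
    intro C D hC
    refine ⟨fun h ρ hρ => (h (Or.inr hρ)).resolve_left ?_, Set.union_subset_union_right K⟩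
    exact Set.disjoint_right.1 (hdisj C hC) hρ
  have hunion : ∀ C D, A.IsClosedIn P C → A.IsClosedIn P D → A.IsClosedIn P (C ∪ D) := by
    intro C D hC hD
    refine ⟨Set.union_subset hC.1 hD.1, ?_⟩
    rintro σ (hσ | hσ) ρ hρ h
    exacts [Or.inl (hC.2 σ hσ ρ hρ h), Or.inr (hD.2 σ hσ ρ hρ h)]
  have hinter : ∀ C D, A.IsClosedIn P C → A.IsClosedIn P D → A.IsClosedIn P (C ∩ D) :=
    fun C D hC hD => ⟨Set.inter_subset_left.trans hC.1, fun σ hσ ρ hρ h =>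
      ⟨hC.2 σ hσ.1 ρ hρ h, hD.2 σ hσ.2 ρ hρ h⟩⟩
  refine
    { subset_rotations := hP
      refl := fun ρ _ => Precedes.refl A ρ
      trans := fun ρ _ σ hσ τ hτ => Precedes.trans (hP hσ) (hP hτ)
      antisymm := fun ρ hρ σ hσ => Precedes.antisymm (hP hρ) (hP hσ)
      generates := fun C hC => generates_of_pastRotations_eq hM (hΦ C hC).1
        (hMK ▸ hdisj C hC) (by rw [(hΦ C hC).2, hMK])
      bijOn := ⟨fun C hC => ?_, fun C hC D hD e => ?_, fun N hN => ?_⟩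
      dominates_iff := fun C D hC hD => ?_
      union_isJoin := fun C D hC hD => ⟨hunion C D hC hD, ?_⟩
      inter_isMeet := fun C D hC hD => ⟨hinter C D hC hD, ?_⟩ }
  · obtain ⟨h1, h2⟩ := hΦ C hC
    rw [hL]
    refine ⟨h1, ?_, ?_⟩ <;> rw [h2]
    exacts [Set.subset_union_left, Set.union_subset_union_right K hC.1]
  · have e' := congrArg A.pastRotations e
    rw [(hΦ C hC).2, (hΦ D hD).2] at e'
    exact ((hsub C D hC).1 e'.subset).antisymm ((hsub D C hD).1 e'.symm.subset)
  · rw [hL] at hN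
    obtain ⟨h1, h2, h3⟩ := hN
    have hC : A.IsClosedIn P (A.pastRotations N \ K) := by
      refine ⟨fun ρ hρ => (h3 hρ.1).resolve_left hρ.2, fun σ hσ ρ hρ h => ⟨?_, ?_⟩⟩
      · exact (isClosedIn_pastRotations h1).2 σ hσ.1 ρ (hP hρ) h
      · exact Set.disjoint_right.1 hPK hρ
    refine ⟨_, hC, pastRotations_injOn (hΦ _ hC).1 h1 ?_⟩
    rw [(hΦ _ hC).2, Set.union_sdiff_cancel h2]
  · rw [← pastRotations_subset_iff (hΦ C hC).1 (hΦ D hD).1, (hΦ C hC).2, (hΦ D hD).2,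
      hsub C D hC]
  · have hCD := hΦ _ (hunion C D hC hD)
    obtain ⟨J, hJ, hjoin⟩ := exists_isJoin (hΦ C hC).1 (hΦ D hD).1
    have e : A.pastRotations J = A.pastRotations (Φ (C ∪ D)) := by
      rw [hjoin.pastRotations_eq (hΦ C hC).1 (hΦ D hD).1, (hΦ C hC).2, (hΦ D hD).2, hCD.2,
        ← Set.union_union_distrib_left]
    rwa [← pastRotations_injOn hJ hCD.1 e]
  · have hCD := hΦ _ (hinter C D hC hD)
    obtain ⟨J, hJ, hmeet⟩ := exists_isMeet (hΦ C hC).1 (hΦ D hD).1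
    have e : A.pastRotations J = A.pastRotations (Φ (C ∩ D)) := by
      rw [hmeet.pastRotations_eq, (hΦ C hC).2, (hΦ D hD).2, hCD.2, Set.union_inter_distrib_left]
    rwa [← pastRotations_injOn hJ hCD.1 e]

theorem lostMatchings_rotation_poset
    (hU : A.IsPrimeFilter U) (hV : A.IsPrimeFilter V)
    (hL : A.lostMatchings B = {M | M ∈ A.stableMatchings ∧ M ∈ U ∧ M ∉ V})
    (hne : (A.lostMatchings B).Nonempty) :
    (A.rotationsInto (A.lostMatchings B)).Subsingleton ∧
    (A.rotationsOutOf (A.lostMatchings B)).Subsingleton ∧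
    ∃ M₀ Mboy : Boy ≃ Girl,
      A.IsBoyOptimalIn A.stableMatchings M₀ ∧
      A.Generates M₀ (A.rotationsIn B) Mboy ∧
      A.IsBoyOptimalIn (A.lostMatchings B) Mboy ∧
      A.IsRotationPosetGenerating (A.rotations \ (A.rotationsIn B ∪ A.rotationsOut B)) Mboy
        (A.lostMatchings B) := by
  classical
  have hmem : ∀ M, M ∈ A.lostMatchings B ↔ M ∈ A.stableMatchings ∧ M ∈ U ∧ M ∉ V := by
    intro M; rw [hL]; rfl
  have hinto : ∀ {ρ M M'}, A.Eliminates ρ M M' → M ∉ A.lostMatchings B →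
      M' ∈ A.lostMatchings B → M ∉ U ∧ M' ∈ U := by
    intro ρ M M' h hM hM'
    rw [hmem] at hM hM'
    exact ⟨fun hMU => hM ⟨h.exposed.stable, hMU, fun hMV =>
      hM'.2.2 (hV.mono M h.exposed.stable M' h.stable h.dominates hMV)⟩, hM'.2.1⟩
  have houtof : ∀ {ρ M M'}, A.Eliminates ρ M M' → M ∈ A.lostMatchings B →
      M' ∉ A.lostMatchings B → M ∉ V ∧ M' ∈ V := by
    intro ρ M M' h hM hM'
    rw [hmem] at hM hM'
    refine ⟨hM.2.2, ?_⟩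
    by_contra hMV
    exact hM' ⟨h.stable, hU.mono M h.exposed.stable M' h.stable h.dominates hM.2.1, hMV⟩
  refine ⟨?_, ?_, ?_⟩
  · rintro ρ ⟨M, M', h, hM, hM'⟩ σ ⟨N, N', h', hN, hN'⟩
    obtain ⟨h1, h2⟩ := hinto h hM hM'
    obtain ⟨h3, h4⟩ := hinto h' hN hN'
    exact hU.eq_of_crossing h h1 h2 h' h3 h4
  · rintro ρ ⟨M, M', h, hM, hM'⟩ σ ⟨N, N', h', hN, hN'⟩
    obtain ⟨h1, h2⟩ := houtof h hM hM'
    obtain ⟨h3, h4⟩ := houtof h' hN hN'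
    exact hV.eq_of_crossing h h1 h2 h' h3 h4
  have hLs : A.lostMatchings B ⊆ A.stableMatchings := fun M h => h.1
  obtain ⟨M₀, hM₀⟩ := exists_boyOptimal (hne.mono hLs)
  have hM₀e := pastRotations_eq_empty hM₀
  obtain ⟨K, hK⟩ := exists_least (A := A) hLs hne fun M hM M' hM' N hN h => by
    rw [hmem] at *
    exact ⟨hN, hU.meet _ hM.2.1 _ hM'.2.1 _ h, fun hNV =>
      hM.2.2 (hV.mono N hN M hM.1 h.dominates_left hNV)⟩
  have hKs := hLs hK.1
  have hKmem := (hmem K).1 hK.1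
  have hKin : A.pastRotations K = A.rotationsIn B := by
    refine Set.Subset.antisymm (fun ρ hρ => ⟨hρ.1, ?_⟩) ?_
    · have hM₀L : M₀ ∉ A.lostMatchings B := by
        intro h
        have := pastRotations_mono (hK.2 M₀ h) hρ
        rw [hM₀e] at this
        exact this
      obtain ⟨l, hl⟩ := exists_eliminatesSeq hM₀.1 hKs (hM₀.2 K hKs)
      obtain ⟨σ, -, N, N', hN, h1, h2⟩ :=
        hl.exists_crossing (P := fun M => M ∉ A.lostMatchings B) hM₀L (not_not.2 hK.1)
      rw [not_not] at h2
      refine ⟨σ, ⟨N, N', hN, h1, h2⟩, ?_⟩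
      obtain ⟨h3, h4⟩ := hinto hN h1 h2
      obtain ⟨m, hm, e⟩ := exists_pastRotations_eq_principal hN.exposed.mem_rotations
      have hmU : m ∈ U := by
        rw [hU.mem_iff hN h3 h4 hm, e]
        exact ⟨hN.exposed.mem_rotations, Precedes.refl A σ⟩
      have hmK : A.Dominates m K := by
        rw [← pastRotations_subset_iff hm hKs, e]
        exact fun τ hτ => (isClosedIn_pastRotations hKs).2 σ
          ((hU.mem_iff hN h3 h4 hKs).1 hKmem.2.1) τ hτ.1 hτ.2
      have hmL : m ∈ A.lostMatchings B :=
        (hmem m).2 ⟨hm, hmU, fun hmV => hKmem.2.2 (hV.mono m hm K hKs hmK hmV)⟩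
      have := pastRotations_mono (hK.2 m hmL) hρ
      rw [e] at this
      exact this.2
    · rintro ρ ⟨hρ, σ, ⟨N, N', hN, h1, h2⟩, hρσ⟩
      obtain ⟨h3, h4⟩ := hinto hN h1 h2
      exact (isClosedIn_pastRotations hKs).2 σ
        ((hU.mem_iff hN h3 h4 hKs).1 hKmem.2.1) ρ hρ hρσ
  have hchar : ∀ M, M ∈ A.lostMatchings B ↔ M ∈ A.stableMatchings ∧
      A.rotationsIn B ⊆ A.pastRotations M ∧ Disjoint (A.pastRotations M) (A.rotationsOut B) := by
    intro M
    rw [← hKin]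
    constructor
    · intro hM
      refine ⟨hLs hM, pastRotations_mono (hK.2 M hM), Set.disjoint_left.2 ?_⟩
      rintro τ hτ ⟨-, σ, ⟨N, N', hN, h1, h2⟩, hστ⟩
      obtain ⟨h3, h4⟩ := houtof hN h1 h2
      refine ((hmem M).1 hM).2.2 ((hV.mem_iff hN h3 h4 (hLs hM)).2 ?_)
      exact (isClosedIn_pastRotations (hLs hM)).2 τ hτ σ hN.exposed.mem_rotations hστ
    · rintro ⟨hM, hsub, hdisj⟩
      by_contra hML
      -- A path from `K` to a matching that is not lost contains an outgoing rotation, which is then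
      -- past.
      obtain ⟨l, hl⟩ := exists_eliminatesSeq hKs hM ((pastRotations_subset_iff hKs hM).1 hsub)
      obtain ⟨σ, hσ, N, N', hN, h1, h2⟩ :=
        hl.exists_crossing (P := fun M => M ∈ A.lostMatchings B) hK.1 hML
      exact Set.disjoint_left.1 hdisj (hl.mem_iff.1 hσ).1 ⟨hN.exposed.mem_rotations, σ,
        ⟨N, N', hN, h1, h2⟩, Precedes.refl A σ⟩
  have hinout : Disjoint (A.rotationsIn B) (A.rotationsOut B) := by
    rw [← hKin]
    exact ((hchar K).1 hK.1).2.2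
  have hclosed : ∀ C, A.IsClosedIn (A.rotations \ (A.rotationsIn B ∪ A.rotationsOut B)) C →
      ∃ M ∈ A.stableMatchings, A.pastRotations M = A.rotationsIn B ∪ C := by
    intro C hC
    refine exists_pastRotations_eq ⟨K, hKs⟩
      ⟨Set.union_subset (fun ρ hρ => hρ.1) fun ρ hρ => (hC.1 hρ).1, ?_⟩
    rintro σ (hσ | hσ) ρ hρ hρσ
    · rw [← hKin] at hσ ⊢
      exact Or.inl ((isClosedIn_pastRotations hKs).2 σ hσ ρ hρ hρσ)
    -- `Π_out` is closed under successors, so a predecessor of `σ` cannot lie in it.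
    · by_cases hin : ρ ∈ A.rotationsIn B
      · exact Or.inl hin
      refine Or.inr (hC.2 σ hσ ρ ⟨hρ, ?_⟩ hρσ)
      rintro (h | ⟨-, τ, hτ, hτρ⟩)
      · exact hin h
      · exact (hC.1 hσ).2 (Or.inr ⟨(hC.1 hσ).1, τ, hτ, hτρ.trans hρ (hC.1 hσ).1 hρσ⟩)
  -- The default `K` is never taken at a closed `C`, by `hclosed`.
  let Φ : Set (CyclicPairs Boy Girl) → (Boy ≃ Girl) := fun C =>
    if h : ∃ M ∈ A.stableMatchings, A.pastRotations M = A.rotationsIn B ∪ C then h.choose else K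
  refine ⟨M₀, K, hM₀, ?_, hK, Φ, ?_⟩
  · exact generates_of_pastRotations_eq hM₀.1 hKs (by simp [hM₀e]) (by rw [hM₀e, hKin]; simp)
  · refine isRotationPosetVia_of_pastRotations_eq Set.sdiff_subset hKs hKin ?_ ?_ fun C hC => ?_
    · exact Set.disjoint_right.2 fun ρ hρ h => hρ.2 (Or.inl h)
    · ext M
      rw [hchar]
      refine and_congr_right fun hM => and_congr_right fun _ => ⟨fun h ρ hρ => ?_, fun h => ?_⟩
      · by_cases hin : ρ ∈ A.rotationsIn B
        · exact Or.inl hin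
        · exact Or.inr ⟨hρ.1, not_or.2 ⟨hin, Set.disjoint_left.1 h hρ⟩⟩
      · refine Set.disjoint_left.2 fun ρ hρ hout => ?_
        rcases h hρ with h' | h'
        exacts [Set.disjoint_left.1 hinout h' hout, h'.2 (Or.inr hout)]
    · have h := hclosed C hC
      simp only [Φ, dif_pos h]
      exact h.choose_spec

end SMInstance

theorem theorem3p10 {Boy Girl : Type*} {n : ℕ} (A B : SMInstance Boy Girl n)
    (hshift : A.IsGirlShift B ∨ A.IsBoyShift B)
    (hne : (A.lostMatchings B).Nonempty) :
    (A.rotationsInto (A.lostMatchings B)).Subsingleton ∧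
    (A.rotationsOutOf (A.lostMatchings B)).Subsingleton ∧
    ∃ M₀ Mboy : Boy ≃ Girl,
      A.IsBoyOptimalIn A.stableMatchings M₀ ∧
      A.Generates M₀ (A.rotationsIn B) Mboy ∧
      A.IsBoyOptimalIn (A.lostMatchings B) Mboy ∧
      A.IsRotationPosetGenerating (A.rotations \ (A.rotationsIn B ∪ A.rotationsOut B)) Mboy
        (A.lostMatchings B) := by
  obtain ⟨M, hM⟩ := id hne
  -- A list of length `n` bounds the number of boys; a boy `b` is needed to obtain a girl `M b` with
  -- such a list.
  have hBoy : Finite Boy := by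
    rcases isEmpty_or_nonempty Boy with h | ⟨⟨b⟩⟩
    · infer_instance
    · exact Finite.of_equiv _ (A.girlList (M b))
  have hGirl : Finite Girl := Finite.of_equiv _ M
  obtain ⟨U, V, hU, hV, hL⟩ := SMInstance.exists_isPrimeFilter_lostMatchings hshift
  exact SMInstance.lostMatchings_rotation_poset hU hV hL hne
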